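/- Let $m,k\ge 1$, let $\Omega\subset\mathbb C^m$ be open, connected and bounded, and let $\mathcal A(\Omega)$ be the closure in $C(\overline\Omega)$, for the supremum norm, of the functions that are holomorphic on a neighbourhood of $\overline\Omega$. Let $\mathcal Z\subset\Omega$ be a connected hypersurface, i.e. a connected complex submanifold of dimension $m-1$. A function vanishes to order $k$ on $\mathcal Z$ if near each point of $\mathcal Z$ it is of the form $\varphi^k g$ with $g$ holomorphic and $\varphi$ a local defining function of $\mathcal Z$ (so $\mathcal Z=\{\varphi=0\}$ locally and $d\varphi\neq0$ on $\mathcal Z$). Let $\mathcal M$ and $\tilde{\mathcal M}$ be quasi-free Hilbert modules of rank one over $\mathcal A(\Omega)$. That is, each is a Hilbert space completion of $\mathcal A(\Omega)$ such that (1) evaluations at points of $\Omega$ are locally uniformly bounded, (2) multiplication by each $f\in\mathcal A(\Omega)$ is bounded, and (3) a norm-Cauchy sequence in $\mathcal A(\Omega)$ tends to $0$ in norm if and only if it tends to $0$ pointwise on $\Omega$. Elements of $\mathcal M$ are thereby functions on $\Omega$, and $\mathcal M$ has a reproducing kernel $K$. The hermitian holomorphic line bundle of $\mathcal M$ is the bundle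 over $\Omega^*=\{\bar w: w\in\Omega\}$ whose fibre at $\bar w$ is spanned by $K(\cdot,w)$, with the inner product of $\mathcal M$. Let $s$ be a holomorphic frame of it and put $\varrho(w)=\|s(\bar w)\|^2$ for $w\in\Omega$ (for the frame $s(\bar w)=K(\cdot,w)$ this is $K(w,w)$). Let $\tilde s$ and $\tilde\varrho$ be the corresponding objects for $\tilde{\mathcal M}$. Let $\mathcal M_0\subset\mathcal M$ be the submodule of functions vanishing to order $k$ on $\mathcal Z$, and let $\mathcal Q=\mathcal M\ominus\mathcal M_0$ be the quotient module, with action $f\cdot(h+\mathcal M_0)=f\cdot h+\mathcal M_0$. Define $\tilde{\mathcal M}_0$ and $\tilde{\mathcal Q}$ in the same way. (In particular $\mathcal Q,\tilde{\mathcal Q}$ may be any two quotient modules in the class $\mathrm B_k(\Omega,\mathcal Z)$.) Fix any family of holomorphic local coordinate systems $(z_1,\dots,z_m)$ on open subsets of $\Omega$ whose domains cover $\mathcal Z$ and in which $\mathcal Z=\{z_1=0\}$. Then $\mathcal Q$ and $\tilde{\mathcal Q}$ are unitarily isomorphic as Hilbert modules over $\mathcal A(\Omega)$ if and only if $\varrho$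 and $\tilde\varrho$ are equivalent to order $k$ on $\mathcal Z$, i.e. in each of these coordinate systems $$\mathcal D_k\Big(\log\frac{\tilde\varrho}{\varrho}\Big)=0\quad\text{on }\mathcal Z .$$ Here $\mathcal D_k$ is the $k\times k$ (block) array of the operators $\bar P_r P_c$, where $P_c$ runs through $\partial'=(\partial_m,\dots,\partial_2)$, $\partial_1,\partial_1^2,\dots,\partial_1^{k-1}$, and $\bar P_r$ runs through the conjugate operators $\bar\partial'$, $\bar\partial_1,\dots,\bar\partial_1^{k-1}$; $\partial_j=\partial/\partial z_j$ and $\bar\partial_j=\partial/\partial\bar z_j$. -/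

import Mathlib

open scoped InnerProductSpace

noncomputable section

namespace JetQuotient

/-! ### The function algebra `𝒜(Ω)` -/

/-- Continuous functions on the closure of `Ω` that extend to a holomorphic function on some
open neighbourhood of the closure. -/
def holNear {m : ℕ} (Ω : Set (Fin m → ℂ)) : Subalgebra ℂ C(closure Ω, ℂ) where
  carrier := {f | ∃ (U : Set (Fin m → ℂ)) (F : (Fin m → ℂ) → ℂ), IsOpen U ∧ closure Ω ⊆ U ∧
    DifferentiableOn ℂ F U ∧ ∀ x : closure Ω, f x = F x}
  mul_mem' := by
    rintro f g ⟨U, F, hU, hΩU, hF, hf⟩ ⟨V, G, hV, hΩV, hG, hg⟩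
    exact ⟨U ∩ V, fun z => F z * G z, hU.inter hV, Set.subset_inter hΩU hΩV,
      (hF.mono Set.inter_subset_left).mul (hG.mono Set.inter_subset_right),
      fun x => by simp [hf x, hg x]⟩
  add_mem' := by
    rintro f g ⟨U, F, hU, hΩU, hF, hf⟩ ⟨V, G, hV, hΩV, hG, hg⟩
    exact ⟨U ∩ V, fun z => F z + G z, hU.inter hV, Set.subset_inter hΩU hΩV,
      (hF.mono Set.inter_subset_left).add (hG.mono Set.inter_subset_right),
      fun x => by simp [hf x, hg x]⟩
  algebraMap_mem' := fun c =>
    ⟨Set.univ, fun _ => c, isOpen_univ, Set.subset_univ _, differentiableOn_const c,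
      fun _ => rfl⟩

instance {m : ℕ} (Ω : Set (Fin m → ℂ)) : LocallyCompactSpace (closure Ω) :=
  isClosed_closure.isClosedEmbedding_subtypeVal.locallyCompactSpace

/-- `𝒜(Ω)`: the completion, in the supremum norm over the closure of the bounded set `Ω`, of the
functions holomorphic near the closure, i.e. their closure in the Banach algebra of continuous
functions on the compact set `closure Ω`. -/
def funAlg {m : ℕ} (Ω : Set (Fin m → ℂ)) : Subalgebra ℂ C(closure Ω, ℂ) :=
  (holNear Ω).topologicalClosure

/-- The value at a point `w ∈ Ω` of a function in `𝒜(Ω)`, as a linear functional. -/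
def evalAlg {m : ℕ} {Ω : Set (Fin m → ℂ)} (w : Ω) : funAlg Ω →ₗ[ℂ] ℂ where
  toFun f := (f : C(closure Ω, ℂ)) ⟨w, subset_closure w.2⟩
  map_add' _ _ := rfl
  map_smul' _ _ := rfl

/-! ### Quasi-free Hilbert modules of rank one -/

/-- The Hilbert space `H` is (through `incl`) a quasi-free Hilbert module of rank one over
`𝒜(Ω)`: a Hilbert space completion of `𝒜(Ω)` such that evaluations are locally uniformly bounded
on `Ω`, multiplication by each function of `𝒜(Ω)` is bounded, and a norm-Cauchy sequence in `𝒜(Ω)`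
tends to `0` in norm if and only if it tends to `0` pointwise on `Ω`. -/
structure QuasiFreeModule {m : ℕ} (Ω : Set (Fin m → ℂ)) (H : Type*) [NormedAddCommGroup H]
    [InnerProductSpace ℂ H] [CompleteSpace H] where
  incl : funAlg Ω →ₗ[ℂ] H
  denseRange_incl : DenseRange incl
  eval_locally_bounded : ∀ w ∈ Ω, ∃ V ∈ nhds w, ∃ C : ℝ, ∀ v : Ω, (v : Fin m → ℂ) ∈ V →
    ∀ f : funAlg Ω, ‖evalAlg v f‖ ≤ C * ‖incl f‖
  mul_bounded : ∀ f : funAlg Ω, ∃ C : ℝ, ∀ g : funAlg Ω, ‖incl (f * g)‖ ≤ C * ‖incl g‖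
  cauchy_tendsto_zero_iff : ∀ u : ℕ → funAlg Ω, CauchySeq (fun j => incl (u j)) →
    (Filter.Tendsto (fun j => incl (u j)) Filter.atTop (nhds 0) ↔
      ∀ w : Ω, Filter.Tendsto (fun j => evalAlg w (u j)) Filter.atTop (nhds 0))

namespace QuasiFreeModule

variable {m : ℕ} {Ω : Set (Fin m → ℂ)} {H : Type*} [NormedAddCommGroup H]
    [InnerProductSpace ℂ H] [CompleteSpace H]

/-- Evaluation `e_w` at `w ∈ Ω`, extended by continuity from `𝒜(Ω)` to the module. -/
def eval (M : QuasiFreeModule Ω H) (w : Ω) : H →L[ℂ] ℂ :=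
  LinearMap.extendOfNorm (E := funAlg Ω) (Eₗ := H) (F := ℂ) (𝕜 := ℂ) (𝕜₂ := ℂ) (evalAlg w) M.incl

theorem eval_incl (M : QuasiFreeModule Ω H) (w : Ω) (f : funAlg Ω) :
    M.eval w (M.incl f) = evalAlg w f := by
  obtain ⟨V, hV, C, hC⟩ := M.eval_locally_bounded w w.2
  have hb : ∃ C : ℝ, ∀ f : funAlg Ω, ‖evalAlg w f‖ ≤ C * ‖M.incl f‖ :=
    ⟨C, hC w (mem_of_mem_nhds hV)⟩
  have h := LinearMap.extendOfNorm_eq (E := funAlg Ω) (Eₗ := H) (F := ℂ) (𝕜 := ℂ) (𝕜₂ := ℂ)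
    (f := evalAlg w) (e := M.incl)
  have h' := h M.denseRange_incl hb f
  exact h'

/-- The function on `Ω` (extended by `0` to the whole space) given by an element of the module. -/
def toFun (M : QuasiFreeModule Ω H) (h : H) : (Fin m → ℂ) → ℂ :=
  open Classical in fun w => if hw : w ∈ Ω then M.eval ⟨w, hw⟩ h else 0

/-- The module action of `f ∈ 𝒜(Ω)`: multiplication by `f`, extended by continuity from `𝒜(Ω)`. -/
def act (M : QuasiFreeModule Ω H) (f : funAlg Ω) : H →L[ℂ] H :=
  LinearMap.extendOfNorm (E := funAlg Ω) (Eₗ := H) (F := H) (𝕜 := ℂ) (𝕜₂ := ℂ)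
    (M.incl ∘ₗ LinearMap.mulLeft ℂ f) M.incl

theorem act_incl (M : QuasiFreeModule Ω H) (f g : funAlg Ω) :
    M.act f (M.incl g) = M.incl (f * g) := by
  have h := LinearMap.extendOfNorm_eq (E := funAlg Ω) (Eₗ := H) (F := H) (𝕜 := ℂ) (𝕜₂ := ℂ)
    (f := M.incl ∘ₗ LinearMap.mulLeft ℂ f) (e := M.incl)
  have h' := h M.denseRange_incl (M.mul_bounded f) g
  exact h'

/-- The reproducing kernel vector `K(·, w)`, determined by `⟪K(·, w), h⟫ = h(w)`. -/
def kernelVec (M : QuasiFreeModule Ω H) (w : Ω) : H :=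
  (InnerProductSpace.toDual ℂ H).symm (M.eval w)

/-- A holomorphic frame of the hermitian holomorphic line bundle of the module. The bundle lives
over `Ω* = {v | star v ∈ Ω}`, its fibre at `star w` is the line spanned by `K(·, w)` with the inner
product of `H`, and a frame is a holomorphic nowhere vanishing section. -/
structure IsFrame (M : QuasiFreeModule Ω H) (s : (Fin m → ℂ) → H) : Prop where
  differentiableOn : DifferentiableOn ℂ s {v | star v ∈ Ω}
  mem_fibre : ∀ w : Ω, s (star (w : Fin m → ℂ)) ∈ Submodule.span ℂ {M.kernelVec w}
  ne_zero : ∀ w : Ω, s (star (w : Fin m → ℂ)) ≠ 0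

end QuasiFreeModule

/-- The hermitian metric of a line bundle over `Ω*` with respect to a frame `s`, as a function on
`Ω`. For the frame `star w ↦ K(·, w)` this is `w ↦ K(w, w)`. -/
def metric {m : ℕ} {H : Type*} [NormedAddCommGroup H] (s : (Fin m → ℂ) → H) :
    (Fin m → ℂ) → ℝ :=
  fun w => ‖s (star w)‖ ^ 2

/-! ### Hypersurfaces and order of vanishing -/

/-- `φ` is a local defining function of `Z` on the open set `U`. -/
structure IsLocalDefiningFunction {m : ℕ} (Z U : Set (Fin m → ℂ)) (φ : (Fin m → ℂ) → ℂ) :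
    Prop where
  isOpen : IsOpen U
  differentiableOn : DifferentiableOn ℂ φ U
  mem_iff : ∀ z ∈ U, z ∈ Z ↔ φ z = 0
  fderiv_ne_zero : ∀ z ∈ U ∩ Z, fderiv ℂ φ z ≠ 0

/-- `Z ⊆ Ω` is a complex submanifold of codimension one. -/
def IsHypersurface {m : ℕ} (Ω Z : Set (Fin m → ℂ)) : Prop :=
  Z ⊆ Ω ∧ ∀ p ∈ Z, ∃ U ⊆ Ω, p ∈ U ∧ ∃ φ, IsLocalDefiningFunction Z U φ

/-- `f` vanishes to order `k` on `Z`: near each point of `Z` it is a holomorphic multiple of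
`φ ^ k`, for the local defining functions `φ` of `Z`. -/
def VanishesToOrder {m : ℕ} (Z : Set (Fin m → ℂ)) (k : ℕ) (f : (Fin m → ℂ) → ℂ) : Prop :=
  ∀ p ∈ Z, ∀ U φ, p ∈ U → IsLocalDefiningFunction Z U φ →
    ∃ V ⊆ U, p ∈ V ∧ IsOpen V ∧ ∃ g, DifferentiableOn ℂ g V ∧ ∀ z ∈ V, f z = φ z ^ k * g z

/-! ### The quotient module -/

namespace QuasiFreeModule

variable {m : ℕ} {Ω : Set (Fin m → ℂ)} {H : Type*} [NormedAddCommGroup H]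
    [InnerProductSpace ℂ H] [CompleteSpace H]

theorem toFun_add (M : QuasiFreeModule Ω H) (h₁ h₂ : H) (z : Fin m → ℂ) :
    M.toFun (h₁ + h₂) z = M.toFun h₁ z + M.toFun h₂ z := by
  by_cases hz : z ∈ Ω <;> simp [toFun, hz]

theorem toFun_smul (M : QuasiFreeModule Ω H) (c : ℂ) (h : H) (z : Fin m → ℂ) :
    M.toFun (c • h) z = c * M.toFun h z := by
  by_cases hz : z ∈ Ω <;> simp [toFun, hz]

/-- `ℳ₀`: the elements of the module that vanish to order `k` on `Z`. -/
def vanishing (M : QuasiFreeModule Ω H) (Z : Set (Fin m → ℂ)) (k : ℕ) : Submodule ℂ H where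
  carrier := {h | VanishesToOrder Z k (M.toFun h)}
  zero_mem' := by
    intro p _ U φ hpU hφ
    refine ⟨U, subset_rfl, hpU, hφ.isOpen, fun _ => 0, differentiableOn_const 0, fun z _ => ?_⟩
    by_cases hz : z ∈ Ω <;> simp [toFun, hz]
  add_mem' := by
    intro h₁ h₂ H₁ H₂ p hp U φ hpU hφ
    obtain ⟨V₁, hV₁U, hp₁, ho₁, g₁, hg₁, e₁⟩ := H₁ p hp U φ hpU hφ
    obtain ⟨V₂, hV₂U, hp₂, ho₂, g₂, hg₂, e₂⟩ := H₂ p hp U φ hpU hφ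
    refine ⟨V₁ ∩ V₂, fun z hz => hV₁U hz.1, ⟨hp₁, hp₂⟩, ho₁.inter ho₂, fun z => g₁ z + g₂ z,
      (hg₁.mono Set.inter_subset_left).add (hg₂.mono Set.inter_subset_right), fun z hz => ?_⟩
    rw [toFun_add, e₁ z hz.1, e₂ z hz.2]
    ring
  smul_mem' := by
    intro c h H₁ p hp U φ hpU hφ
    obtain ⟨V, hVU, hpV, ho, g, hg, e⟩ := H₁ p hp U φ hpU hφ
    refine ⟨V, hVU, hpV, ho, fun z => c * g z, hg.const_mul c, fun z hz => ?_⟩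
    rw [toFun_smul, e z hz]
    ring

/-- `𝒬 = ℳ ⊖ ℳ₀`, the Hilbert space underlying the quotient module. -/
abbrev quotient (M : QuasiFreeModule Ω H) (Z : Set (Fin m → ℂ)) (k : ℕ) : Submodule ℂ H :=
  (M.vanishing Z k)ᗮ

/-- The module action on `𝒬`: `f · (h + ℳ₀) = f · h + ℳ₀`, where a class is represented by its
unique element orthogonal to `ℳ₀`. -/
def quotientAct (M : QuasiFreeModule Ω H) (Z : Set (Fin m → ℂ)) (k : ℕ) (f : funAlg Ω)
    (h : M.quotient Z k) : M.quotient Z k :=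
  (M.quotient Z k).orthogonalProjectionOnto (M.act f h)

end QuasiFreeModule

/-- The quotient modules of `M` and `M'` are (unitarily) isomorphic Hilbert modules over
`𝒜(Ω)`. -/
def QuotientsIsomorphic {m : ℕ} {Ω : Set (Fin m → ℂ)} {H H' : Type*}
    [NormedAddCommGroup H] [InnerProductSpace ℂ H] [CompleteSpace H]
    [NormedAddCommGroup H'] [InnerProductSpace ℂ H'] [CompleteSpace H']
    (M : QuasiFreeModule Ω H) (M' : QuasiFreeModule Ω H') (Z : Set (Fin m → ℂ)) (k : ℕ) : Prop :=
  ∃ V : M.quotient Z k ≃ₗᵢ[ℂ] M'.quotient Z k, ∀ (f : funAlg Ω) (h : M.quotient Z k),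
    V (M.quotientAct Z k f h) = M'.quotientAct Z k f (V h)

/-! ### The operators `𝒟_k` and equivalence to order `k` -/

/-- `∂/∂z_j` -/
def del {m : ℕ} (j : Fin m) (F : (Fin m → ℂ) → ℂ) : (Fin m → ℂ) → ℂ := fun z =>
  (fderiv ℝ F z (Pi.single j 1) - Complex.I * fderiv ℝ F z (Pi.single j Complex.I)) / 2

/-- `∂/∂z̄_j` -/
def delBar {m : ℕ} (j : Fin m) (F : (Fin m → ℂ) → ℂ) : (Fin m → ℂ) → ℂ := fun z =>
  (fderiv ℝ F z (Pi.single j 1) + Complex.I * fderiv ℝ F z (Pi.single j Complex.I)) / 2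

/-- The operators heading the columns of `𝒟_k`: the tangential `∂_j` (`j` not the first
coordinate), then `∂_1, ∂_1², …, ∂_1^(k-1)`. -/
def colOp {n k : ℕ} : Fin n ⊕ Fin (k - 1) → ((Fin (n + 1) → ℂ) → ℂ) → (Fin (n + 1) → ℂ) → ℂ
  | Sum.inl j => del j.succ
  | Sum.inr b => (del 0)^[(b : ℕ) + 1]

/-- The operators heading the rows of `𝒟_k`, conjugate to those heading the columns. -/
def rowOp {n k : ℕ} : Fin n ⊕ Fin (k - 1) → ((Fin (n + 1) → ℂ) → ℂ) → (Fin (n + 1) → ℂ) → ℂ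
  | Sum.inl i => delBar i.succ
  | Sum.inr a => (delBar 0)^[(a : ℕ) + 1]

/-- The array `𝒟_k F` at the point `z`; the `(1,1)` block is indexed by `Fin n × Fin n`. -/
def diffArray {n : ℕ} (k : ℕ) (F : (Fin (n + 1) → ℂ) → ℂ) (z : Fin (n + 1) → ℂ) :
    Matrix (Fin n ⊕ Fin (k - 1)) (Fin n ⊕ Fin (k - 1)) ℂ :=
  Matrix.of fun r c => rowOp r (colOp c F) z

/-- Holomorphic local coordinates on an open subset of `Ω` in which `Z` is the zero set of the
first coordinate. -/
structure IsAdaptedChart {n : ℕ} (Ω Z : Set (Fin (n + 1) → ℂ))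
    (e : OpenPartialHomeomorph (Fin (n + 1) → ℂ) (Fin (n + 1) → ℂ)) : Prop where
  source_subset : e.source ⊆ Ω
  differentiableOn : DifferentiableOn ℂ e e.source
  differentiableOn_symm : DifferentiableOn ℂ e.symm e.target
  mem_iff : ∀ z ∈ e.source, z ∈ Z ↔ e z 0 = 0

/-- `ρ` and `ρ'` are equivalent to order `k` on `Z`: in the given coordinate systems,
`𝒟_k (log (ρ' / ρ)) = 0` at all points of `Z`. -/
def EquivalentToOrder {n : ℕ} (Z : Set (Fin (n + 1) → ℂ))
    (charts : Set (OpenPartialHomeomorph (Fin (n + 1) → ℂ) (Fin (n + 1) → ℂ))) (k : ℕ)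
    (ρ ρ' : (Fin (n + 1) → ℂ) → ℝ) : Prop :=
  ∀ e ∈ charts, ∀ z ∈ e.source ∩ Z,
    diffArray k (fun x => ((Real.log (ρ' (e.symm x) / ρ (e.symm x)) : ℝ) : ℂ)) (e z) = 0

end JetQuotient

end

/-! Written in the coordinates conjugate to a chart, a frame becomes a holomorphic map `S`, and κ(x,
y) = ⟪S(x̄), S(y)⟫ is holomorphic in both variables and equals the metric on y = x̄. Since ⟪h, S(y)⟫
is the conjugate of the value of h times the zero-free holomorphic factor ⟪1, S(y)⟫, an element h
vanishes to order k along the slice exactly when it is orthogonal to the normal jets ∂₀^a S(y) with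
a < k and y₀ = 0. By the identity theorem and the connectedness of Z, the jets over one polydisc
detect this on all of Z. So they form a total family in the quotient, and adjoints of the module
action move them by the Leibniz rule.

Hence equal Gram matrices of jets give isomorphic quotients (`quotientsIsomorphic_of_gram`).
Conversely, a unitary module map V must send the jets of S to those of χS' for a holomorphic χ,
found by pairing S with the preimage under V of the class of 1 (`exists_smul_gram_eq`). Equality of
Gram matrices means that the difference of the two kernels κ has vanishing mixed normal derivatives
of orders below k in x and in y on the slice x₀ = y₀ = 0 (`JetVanish`,
`jetVanish_polarKernel_sub_iff`). Functions with this property form an ideal, stable under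
composition with holomorphic φ such that φ(0) = 0.

It remains to compare this with 𝒟_k. Modulo the ideal, equality of kernels up to χ makes log(κ'/κ) a
sum A(x) + B(y). Each entry of 𝒟_k differentiates at least once in x and once in y, so it kills A +
B; it also kills the ideal on the slice (`diffArray_log_eq_zero`). Conversely, 𝒟_k log(ρ'/ρ) = 0 on
Z polarises from y = x̄ to the whole slice. Subtracting separated terms makes the logarithm vanish
for x = q and for y = q̄, with q the centre. Then first order tangential derivatives suffice,
because the remaining jets are obtained by integrating along the slice from the centre.
Exponentiating the separated terms gives χ, by the hermitian symmetry of κ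
(`exists_jetVanish_of_diffArray_eq_zero`). -/

noncomputable section

namespace JetQuotient

open Set Metric Filter Topology MeasureTheory

/-! ### Holomorphic maps on finite-dimensional spaces: Cauchy estimates and derivatives. -/

section Calculus

variable {E X : Type*} [NormedAddCommGroup E] [NormedSpace ℂ E]
  [NormedAddCommGroup X] [NormedSpace ℂ X]

/-- Cauchy estimate for the derivative. -/
theorem norm_fderiv_le_of_norm_le_on_ball {f : E → X} {x : E} {r C : ℝ} (hr : 0 < r)
    (hf : DifferentiableOn ℂ f (ball x r)) (hC : ∀ y ∈ ball x r, ‖f y‖ ≤ C) :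
    ‖fderiv ℂ f x‖ ≤ 2 * C / r := by
  refine Complex.norm_fderiv_le_div_of_mapsTo_ball hf (fun y hy => ?_) hr
  rw [mem_closedBall, dist_eq_norm]
  calc ‖f y - f x‖ ≤ ‖f y‖ + ‖f x‖ := norm_sub_le _ _
    _ ≤ 2 * C := by linarith [hC y hy, hC x (mem_ball_self hr)]

/-- Integrals of holomorphic functions depending continuously on a parameter are holomorphic. -/
theorem differentiableOn_intervalIntegral [FiniteDimensional ℂ E] {U : Set E} (hU : IsOpen U)
    {G : E → ℝ → X} {a b : ℝ} (hab : a ≤ b)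
    (hG : ∀ t ∈ Icc a b, DifferentiableOn ℂ (fun x => G x t) U)
    (hcont : ContinuousOn (Function.uncurry G) (U ×ˢ Icc a b)) :
    DifferentiableOn ℂ (fun x => ∫ t in a..b, G x t) U := by
  intro x₀ hx₀
  have : ProperSpace E := FiniteDimensional.proper ℂ E
  obtain ⟨δ, hδ, hball⟩ : ∃ δ > 0, closedBall x₀ (2 * δ) ⊆ U := by
    obtain ⟨ε, hε, h⟩ := Metric.isOpen_iff.1 hU x₀ hx₀
    exact ⟨ε / 4, by positivity, (closedBall_subset_ball (by linarith)).trans h⟩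
  have hK : IsCompact (closedBall x₀ (2 * δ) ×ˢ Icc a b) :=
    (isCompact_closedBall _ _).prod isCompact_Icc
  have hcK := hcont.mono (Set.prod_mono hball subset_rfl)
  obtain ⟨C, hC⟩ := hK.exists_bound_of_continuousOn hcK
  have huc := hK.uniformContinuousOn_of_continuous hcK
  have hIoc : ∀ t, t ∈ Set.uIoc a b → t ∈ Icc a b := fun t ht => by
    rw [uIoc_of_le hab] at ht; exact Ioc_subset_Icc_self ht
  have hslice : ∀ x ∈ U, ContinuousOn (G x) (Icc a b) := fun x hx =>
    hcont.comp (f := fun t => (x, t)) (by fun_prop) fun t ht => ⟨hx, ht⟩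
  have hint : ∀ x ∈ U, IntervalIntegrable (G x) volume a b := fun x hx =>
    ContinuousOn.intervalIntegrable (by rw [uIcc_of_le hab]; exact hslice x hx)
  -- Only needed for measurability of the derivative in `t`. The Cauchy estimate, applied to a
  -- difference of two slices, turns uniform continuity of `G` into continuity of the derivative.
  have hderiv : ContinuousOn (fun t => fderiv ℂ (fun x => G x t) x₀) (Icc a b) := by
    rw [Metric.continuousOn_iff]
    intro t ht ε hε
    rw [Metric.uniformContinuousOn_iff] at huc
    obtain ⟨η, hη, h⟩ := huc (ε * δ / 4) (by positivity)
    refine ⟨η, hη, fun u hu hut => ?_⟩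
    have hsub : ball x₀ δ ⊆ closedBall x₀ (2 * δ) :=
      ball_subset_closedBall.trans (closedBall_subset_closedBall (by linarith))
    have hd : ∀ w ∈ Icc a b, DifferentiableOn ℂ (fun x => G x w) (ball x₀ δ) :=
      fun w hw => (hG w hw).mono (hsub.trans hball)
    have hda : ∀ w ∈ Icc a b, DifferentiableAt ℂ (fun x => G x w) x₀ := fun w hw =>
      (hG w hw).differentiableAt (hU.mem_nhds hx₀)
    have := norm_fderiv_le_of_norm_le_on_ball (C := ε * δ / 4) hδ ((hd u hu).sub (hd t ht))
      (fun y hy => by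
        have := h (y, u) ⟨hsub hy, hu⟩ (y, t) ⟨hsub hy, ht⟩ (by
          rw [Prod.dist_eq]; simpa using hut)
        rw [dist_eq_norm] at this
        exact this.le)
    rw [dist_eq_norm]
    have e : fderiv ℂ ((fun x => G x u) - fun x => G x t) x₀ =
      fderiv ℂ (fun x => G x u) x₀ - fderiv ℂ (fun x => G x t) x₀ :=
      fderiv_sub (hda u hu) (hda t ht)
    rw [← e]
    refine this.trans_lt ?_
    rw [div_lt_iff₀ hδ]
    nlinarith
  have key := intervalIntegral.hasFDerivAt_integral_of_dominated_of_fderiv_le (𝕜 := ℂ)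
    (μ := volume) (F := G) (F' := fun x t => fderiv ℂ (fun x => G x t) x) (x₀ := x₀)
    (a := a) (b := b) (s := ball x₀ δ) (bound := fun _ => 2 * C / δ) (ball_mem_nhds _ hδ)
    (by
      filter_upwards [hU.mem_nhds hx₀] with x hx
      exact (intervalIntegrable_iff.1 (hint x hx)).aestronglyMeasurable)
    (hint x₀ hx₀)
    (by
      rw [uIoc_of_le hab]
      exact ((hderiv.mono Ioc_subset_Icc_self).aestronglyMeasurable measurableSet_Ioc))
    (by
      refine Eventually.of_forall fun t ht x hx => ?_
      have hs : ball x δ ⊆ closedBall x₀ (2 * δ) := fun y hy => by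
        rw [mem_closedBall]
        rw [mem_ball] at hx hy
        linarith [dist_triangle y x x₀]
      exact norm_fderiv_le_of_norm_le_on_ball hδ ((hG t (hIoc t ht)).mono (hs.trans hball))
        fun y hy => hC (y, t) ⟨hs hy, hIoc t ht⟩)
    intervalIntegrable_const
    (by
      refine Eventually.of_forall fun t ht x hx => ?_
      refine ((hG t (hIoc t ht)).differentiableAt (hU.mem_nhds (hball ?_))).hasFDerivAt
      rw [mem_closedBall]; rw [mem_ball] at hx; linarith)
  exact key.differentiableAt.differentiableWithinAt

/-- The derivative in the direction `v`. -/
def dirDeriv (v : E) (f : E → X) : E → X := fun z => fderiv ℂ f z v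

theorem deriv_line {f : E → X} {z v : E} {t : ℂ} (hf : DifferentiableAt ℂ f (z + t • v)) :
    deriv (fun t : ℂ => f (z + t • v)) t = dirDeriv v f (z + t • v) := by
  have h : HasDerivAt (fun t : ℂ => z + t • v) v t := by
    simpa using ((hasDerivAt_id t).smul_const v).const_add z
  exact (hf.hasFDerivAt.comp_hasDerivAt t h).deriv

variable [CompleteSpace X]

/-- On the complex line through `x` in the direction `v`, Cauchy's formula writes the derivative as
a circle integral of `f`. The circle has a radius independent of `x` near `x₀`, so this is an
integral of holomorphic functions of `x`. -/
theorem differentiableOn_dirDeriv [FiniteDimensional ℂ E] {U : Set E} (hU : IsOpen U)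
    {f : E → X} (hf : DifferentiableOn ℂ f U) (v : E) : DifferentiableOn ℂ (dirDeriv v f) U := by
  intro x₀ hx₀
  have : ProperSpace E := FiniteDimensional.proper ℂ E
  obtain ⟨ε, hε, hball⟩ := Metric.isOpen_iff.1 hU x₀ hx₀
  obtain ⟨ρ, hρ, hρv⟩ : ∃ ρ > 0, ρ * ‖v‖ < ε / 2 := by
    refine ⟨ε / 2 / (‖v‖ + 1), by positivity, ?_⟩
    rw [div_mul_eq_mul_div, div_lt_iff₀ (by positivity)]
    nlinarith [norm_nonneg v]
  have hmem : ∀ x ∈ ball x₀ (ε / 2), ∀ t : ℂ, ‖t‖ ≤ ρ → x + t • v ∈ U := fun x hx t ht => by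
    refine hball ?_
    rw [mem_ball, dist_eq_norm] at hx ⊢
    have h1 : ‖t • v‖ < ε / 2 := by
      rw [norm_smul]
      exact (mul_le_mul_of_nonneg_right ht (norm_nonneg v)).trans_lt hρv
    calc ‖x + t • v - x₀‖ = ‖(x - x₀) + t • v‖ := by congr 1; abel
      _ ≤ ‖x - x₀‖ + ‖t • v‖ := norm_add_le _ _
      _ < ε := by linarith
  have hline : ∀ x, Differentiable ℂ (fun t : ℂ => x + t • v) := fun x => by fun_prop
  have hcauchy : ∀ x ∈ ball x₀ (ε / 2), dirDeriv v f x =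
      (2 * Real.pi * Complex.I : ℂ)⁻¹ • ∮ w in C(0, ρ), ((w - 0) ^ 2)⁻¹ • f (x + w • v) := by
    intro x hx
    have hU' : IsOpen ((fun t : ℂ => x + t • v) ⁻¹' U) := hU.preimage (hline x).continuous
    have h := Complex.cderiv_eq_deriv (z := 0) (r := ρ) (f := fun t : ℂ => f (x + t • v)) hU'
      (hf.comp (hline x).differentiableOn fun t ht => ht) hρ
      (fun t ht => hmem x hx t (by simpa using ht))
    rw [Complex.cderiv] at h
    rw [h, deriv_line]
    · simp
    · exact hf.differentiableAt (hU.mem_nhds (hmem x hx 0 (by simpa using hρ.le)))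
  have hcirc : ∀ θ : ℝ, ‖circleMap 0 ρ θ‖ = ρ := fun θ => by
    simp [abs_of_pos hρ]
  have hne : ∀ θ : ℝ, circleMap 0 ρ θ ≠ 0 := fun θ h0 => by
    have := hcirc θ
    rw [h0, norm_zero] at this
    exact hρ.ne this
  have hd : DifferentiableOn ℂ (fun x => ∮ w in C(0, ρ), ((w - 0) ^ 2)⁻¹ • f (x + w • v))
      (ball x₀ (ε / 2)) := by
    unfold circleIntegral
    refine differentiableOn_intervalIntegral isOpen_ball Real.two_pi_pos.le (fun θ _ => ?_) ?_
    · refine DifferentiableOn.const_smul (DifferentiableOn.const_smul ?_ _) _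
      exact hf.comp (by fun_prop) fun x hx => hmem x hx _ (hcirc θ).le
    · have hc : ContinuousOn (fun p : E × ℝ => f (p.1 + circleMap 0 ρ p.2 • v))
          (ball x₀ (ε / 2) ×ˢ Icc 0 (2 * Real.pi)) :=
        hf.continuousOn.comp (Continuous.continuousOn
          (continuous_fst.add (((continuous_circleMap 0 ρ).comp continuous_snd).smul
            continuous_const))) fun p hp => hmem _ hp.1 _ (hcirc _).le
      have h1 : Continuous fun p : E × ℝ => deriv (circleMap 0 ρ) p.2 := by
        simp only [deriv_circleMap]
        exact ((continuous_circleMap 0 ρ).comp continuous_snd).mul continuous_const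
      have h2 : Continuous fun p : E × ℝ => ((circleMap 0 ρ p.2 - 0) ^ 2)⁻¹ := by
        refine Continuous.inv₀ ?_ fun p => by simpa using hne p.2
        exact (((continuous_circleMap 0 ρ).comp continuous_snd).sub continuous_const).pow 2
      exact h1.continuousOn.smul (h2.continuousOn.smul hc)
  have : DifferentiableOn ℂ (dirDeriv v f) (ball x₀ (ε / 2)) :=
    (hd.const_smul ((2 * Real.pi * Complex.I : ℂ)⁻¹)).congr fun x hx => hcauchy x hx
  exact (this.differentiableAt (ball_mem_nhds _ (by positivity))).differentiableWithinAt

theorem contDiffOn_of_differentiableOn [FiniteDimensional ℂ E] {U : Set E} (hU : IsOpen U)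
    (n : ℕ) {f : E → X} (hf : DifferentiableOn ℂ f U) : ContDiffOn ℂ n f U := by
  induction n generalizing f with
  | zero => exact contDiffOn_zero.2 hf.continuousOn
  | succ n ih =>
    rw [Nat.cast_add, Nat.cast_one, contDiffOn_succ_iff_fderiv_of_isOpen hU]
    refine ⟨hf, fun h => absurd h (by simp), contDiffOn_clm_apply.2 fun v => ?_⟩
    exact ih (differentiableOn_dirDeriv hU hf v)

theorem dirDeriv_comm [FiniteDimensional ℂ E] {U : Set E} (hU : IsOpen U) {f : E → X}
    (hf : DifferentiableOn ℂ f U) (v w : E) {z : E} (hz : z ∈ U) :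
    dirDeriv v (dirDeriv w f) z = dirDeriv w (dirDeriv v f) z := by
  have hcd : ContDiffAt ℂ 2 f z := (contDiffOn_of_differentiableOn hU 2 hf).contDiffAt
    (hU.mem_nhds hz)
  have hsymm := hcd.isSymmSndFDerivAt (by simp)
  have hd : DifferentiableAt ℂ (fderiv ℂ f) z :=
    (hcd.fderiv_right (m := 1) (by norm_num)).differentiableAt (by norm_num)
  have h : ∀ v w : E, dirDeriv v (dirDeriv w f) z = fderiv ℂ (fderiv ℂ f) z v w := fun v w => by
    unfold dirDeriv
    rw [fderiv_clm_apply hd (differentiableAt_const w)]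
    simp
  rw [h, h, hsymm.eq]

end Calculus

/-! ### Calculus of iterated directional derivatives. -/

section DirDeriv

variable {E X Y : Type*} [NormedAddCommGroup E] [NormedSpace ℂ E]
  [NormedAddCommGroup X] [NormedSpace ℂ X] [NormedAddCommGroup Y] [NormedSpace ℂ Y]
  {U : Set E} {v w : E}

theorem dirDeriv_congr (hU : IsOpen U) {f g : E → X} (h : EqOn f g U) :
    EqOn (dirDeriv v f) (dirDeriv v g) U := fun z hz => by
  unfold dirDeriv
  rw [Filter.EventuallyEq.fderiv_eq (h.eventuallyEq_of_mem (hU.mem_nhds hz))]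

theorem iterate_dirDeriv_congr (hU : IsOpen U) {f g : E → X} (h : EqOn f g U) (a : ℕ) :
    EqOn ((dirDeriv v)^[a] f) ((dirDeriv v)^[a] g) U := by
  induction a generalizing f g with
  | zero => exact h
  | succ a ih => exact ih (dirDeriv_congr hU h)

theorem dirDeriv_zero : dirDeriv v (fun _ : E => (0 : X)) = fun _ => 0 := by
  funext z; simp [dirDeriv]

theorem iterate_dirDeriv_zero (a : ℕ) :
    (dirDeriv v)^[a] (fun _ : E => (0 : X)) = fun _ => 0 := by
  induction a with
  | zero => rfl
  | succ a ih => rw [Function.iterate_succ_apply, dirDeriv_zero, ih]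

theorem dirDeriv_add (hU : IsOpen U) {f g : E → X} (hf : DifferentiableOn ℂ f U)
    (hg : DifferentiableOn ℂ g U) :
    EqOn (dirDeriv v fun z => f z + g z) (fun z => dirDeriv v f z + dirDeriv v g z) U :=
  fun z hz => by
    have := fderiv_add (hf.differentiableAt (hU.mem_nhds hz)) (hg.differentiableAt (hU.mem_nhds hz))
    unfold dirDeriv
    erw [this]
    simp

theorem dirDeriv_smul (hU : IsOpen U) {g : E → ℂ} {f : E → X} (hg : DifferentiableOn ℂ g U)
    (hf : DifferentiableOn ℂ f U) :
    EqOn (dirDeriv v fun z => g z • f z)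
      (fun z => dirDeriv v g z • f z + g z • dirDeriv v f z) U := fun z hz => by
  have := fderiv_fun_smul (hg.differentiableAt (hU.mem_nhds hz))
    (hf.differentiableAt (hU.mem_nhds hz))
  unfold dirDeriv
  rw [this]
  simp [add_comm]

theorem dirDeriv_clm (hU : IsOpen U) {f : E → X} (hf : DifferentiableOn ℂ f U) (L : X →L[ℂ] Y) :
    EqOn (dirDeriv v fun z => L (f z)) (fun z => L (dirDeriv v f z)) U := fun z hz => by
  unfold dirDeriv
  have h : HasFDerivAt (fun z => L (f z)) (L.comp (fderiv ℂ f z)) z :=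
    L.hasFDerivAt.comp z (hf.differentiableAt (hU.mem_nhds hz)).hasFDerivAt
  rw [h.fderiv]
  rfl

variable [CompleteSpace X] [CompleteSpace Y] [FiniteDimensional ℂ E]

theorem differentiableOn_iterate_dirDeriv (hU : IsOpen U) {f : E → X}
    (hf : DifferentiableOn ℂ f U) (a : ℕ) : DifferentiableOn ℂ ((dirDeriv v)^[a] f) U := by
  induction a generalizing f with
  | zero => exact hf
  | succ a ih => exact ih (differentiableOn_dirDeriv hU hf v)

theorem iterate_dirDeriv_add (hU : IsOpen U) {f g : E → X} (hf : DifferentiableOn ℂ f U)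
    (hg : DifferentiableOn ℂ g U) (a : ℕ) :
    EqOn ((dirDeriv v)^[a] fun z => f z + g z)
      (fun z => (dirDeriv v)^[a] f z + (dirDeriv v)^[a] g z) U := by
  induction a generalizing f g with
  | zero => exact fun z _ => rfl
  | succ a ih =>
    exact (iterate_dirDeriv_congr hU (dirDeriv_add hU hf hg) a).trans
      (ih (differentiableOn_dirDeriv hU hf v) (differentiableOn_dirDeriv hU hg v))

omit [CompleteSpace Y] in
theorem iterate_dirDeriv_clm (hU : IsOpen U) {f : E → X} (hf : DifferentiableOn ℂ f U)
    (L : X →L[ℂ] Y) (a : ℕ) :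
    EqOn ((dirDeriv v)^[a] fun z => L (f z)) (fun z => L ((dirDeriv v)^[a] f z)) U := by
  induction a generalizing f with
  | zero => exact fun z _ => rfl
  | succ a ih =>
    exact (iterate_dirDeriv_congr hU (dirDeriv_clm hU hf L) a).trans
      (ih (differentiableOn_dirDeriv hU hf v))

theorem iterate_dirDeriv_sub (hU : IsOpen U) {f g : E → X} (hf : DifferentiableOn ℂ f U)
    (hg : DifferentiableOn ℂ g U) (a : ℕ) :
    EqOn ((dirDeriv v)^[a] fun z => f z - g z)
      (fun z => (dirDeriv v)^[a] f z - (dirDeriv v)^[a] g z) U := fun z hz => by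
  have h := iterate_dirDeriv_clm (v := v) hU hg (-ContinuousLinearMap.id ℂ X) a hz
  have h2 := iterate_dirDeriv_add (v := v) hU hf (g := fun z => -g z) hg.neg a hz
  simp only [sub_eq_add_neg]
  exact h2.trans (congrArg _ h)

theorem dirDeriv_iterate_comm (hU : IsOpen U) {f : E → X} (hf : DifferentiableOn ℂ f U) (a : ℕ) :
    EqOn (dirDeriv w ((dirDeriv v)^[a] f)) ((dirDeriv v)^[a] (dirDeriv w f)) U := by
  induction a generalizing f with
  | zero => exact fun z _ => rfl
  | succ a ih =>
    exact (ih (differentiableOn_dirDeriv hU hf v)).trans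
      (iterate_dirDeriv_congr hU (fun z hz => dirDeriv_comm hU hf w v hz) a)

theorem iterate_dirDeriv_succ_smul (hU : IsOpen U) {g : E → ℂ} {f : E → X}
    (hg : DifferentiableOn ℂ g U) (hf : DifferentiableOn ℂ f U) (a : ℕ) :
    EqOn ((dirDeriv v)^[a + 1] fun z => g z • f z)
      (fun z => (dirDeriv v)^[a] (fun z => dirDeriv v g z • f z) z +
        (dirDeriv v)^[a] (fun z => g z • dirDeriv v f z) z) U :=
  (iterate_dirDeriv_congr hU (dirDeriv_smul hU hg hf) a).trans
    (iterate_dirDeriv_add hU ((differentiableOn_dirDeriv hU hg v).smul hf)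
      (hg.smul (differentiableOn_dirDeriv hU hf v)) a)

/-- If a linear map matches the directional derivatives of `S` and `S'` at a point up to some
order, then it does so for `g • S` and `g • S'`. -/
theorem clm_iterate_dirDeriv_smul (hU : IsOpen U) {g : E → ℂ} {S : E → X} {S' : E → Y}
    (hg : DifferentiableOn ℂ g U) (hS : DifferentiableOn ℂ S U) (hS' : DifferentiableOn ℂ S' U)
    (L : X →L[ℂ] Y) {z : E} (hz : z ∈ U) {a : ℕ}
    (h : ∀ b ≤ a, L ((dirDeriv v)^[b] S z) = (dirDeriv v)^[b] S' z) :
    L ((dirDeriv v)^[a] (fun z => g z • S z) z) = (dirDeriv v)^[a] (fun z => g z • S' z) z := by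
  -- Keeping `g`, `S` and `S'` free in the induction replaces the binomial Leibniz formula: one
  -- derivative falls on `g` or on `S`, and both terms have the same shape with one order less.
  induction a generalizing g S S' with
  | zero => simpa using congrArg (g z • ·) (h 0 le_rfl)
  | succ a ih =>
    rw [iterate_dirDeriv_succ_smul hU hg hS a hz, iterate_dirDeriv_succ_smul hU hg hS' a hz,
      map_add, ih (differentiableOn_dirDeriv hU hg v) hS hS' fun b hb => h b (by omega),
      ih hg (differentiableOn_dirDeriv hU hS v) (differentiableOn_dirDeriv hU hS' v)
        fun b hb => h (b + 1) (by omega)]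

theorem iterate_dirDeriv_smul_eq_zero (hU : IsOpen U) {g : E → ℂ} {f : E → X}
    (hg : DifferentiableOn ℂ g U) (hf : DifferentiableOn ℂ f U) {z : E} (hz : z ∈ U) {a : ℕ}
    (h : ∀ b ≤ a, (dirDeriv v)^[b] f z = 0) :
    (dirDeriv v)^[a] (fun z => g z • f z) z = 0 := by
  have := clm_iterate_dirDeriv_smul (v := v) hU hg hf (differentiableOn_const (0 : X))
    (ContinuousLinearMap.id ℂ X) hz (a := a) fun b hb => by
      rw [iterate_dirDeriv_zero]; exact h b hb
  simpa [iterate_dirDeriv_zero] using this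

theorem iterate_dirDeriv_iterate_smul_eq_zero (hU : IsOpen U) {g : E → ℂ} {f : E → X}
    (hg : DifferentiableOn ℂ g U) (hf : DifferentiableOn ℂ f U) {z : E} (hz : z ∈ U) {a b : ℕ}
    (h : ∀ a' ≤ a, ∀ b' ≤ b, (dirDeriv v)^[a'] ((dirDeriv w)^[b'] f) z = 0) :
    (dirDeriv v)^[a] ((dirDeriv w)^[b] fun z => g z • f z) z = 0 := by
  induction b generalizing g f with
  | zero => exact iterate_dirDeriv_smul_eq_zero hU hg hf hz fun a' ha' => h a' ha' 0 le_rfl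
  | succ b ih =>
    have hDg := differentiableOn_dirDeriv hU hg w
    have hDf := differentiableOn_dirDeriv hU hf w
    rw [iterate_dirDeriv_congr hU (iterate_dirDeriv_succ_smul hU hg hf b) a hz,
      iterate_dirDeriv_add hU
        (differentiableOn_iterate_dirDeriv (f := fun z => dirDeriv w g z • f z) hU (hDg.smul hf) b)
        (differentiableOn_iterate_dirDeriv (f := fun z => g z • dirDeriv w f z) hU
          (hg.smul hDf) b) a hz]
    simp only
    rw [ih hDg hf fun a' ha' b' hb' => h a' ha' b' (by omega),
      ih hg hDf fun a' ha' b' hb' => h a' ha' (b' + 1) (by omega), add_zero]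

end DirDeriv

/-! ### The identity theorem on complex lines, and polarisation. -/

section Identity

variable {E X : Type*} [NormedAddCommGroup E] [NormedSpace ℂ E]
  [NormedAddCommGroup X] [NormedSpace ℂ X] [CompleteSpace X]

omit [CompleteSpace X] [NormedSpace ℂ X] [NormedAddCommGroup X] in
theorem convex_preimage_line {U : Set E} (hconv : Convex ℝ U) (z v : E) :
    Convex ℝ ((fun t : ℂ => z + t • v) ⁻¹' U) := by
  intro s hs t ht a b ha hb hab
  have := hconv hs ht ha hb hab
  simp only [mem_preimage]
  convert this using 1
  have h1 : (a : ℂ) + b = 1 := by exact_mod_cast hab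
  have h2 : z = (a : ℂ) • z + (b : ℂ) • z := by rw [← add_smul, h1, one_smul]
  simp only [smul_add, add_smul, ← Complex.coe_smul, smul_assoc]
  conv_lhs => rw [h2]
  abel

/-- Identity theorem along a complex line. -/
theorem eq_zero_of_frequently_line {U : Set E} (hU : IsOpen U) {f : E → X}
    (hf : DifferentiableOn ℂ f U) {z v : E} (hconv : Convex ℝ ((fun t : ℂ => z + t • v) ⁻¹' U))
    (hz : z ∈ U) {t : ℂ} (ht : z + t • v ∈ U)
    (h : ∃ᶠ s in 𝓝[≠] (0 : ℂ), f (z + s • v) = 0) : f (z + t • v) = 0 := by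
  have hline : Differentiable ℂ (fun t : ℂ => z + t • v) := by fun_prop
  have hopen : IsOpen ((fun t : ℂ => z + t • v) ⁻¹' U) := hU.preimage hline.continuous
  have han : AnalyticOnNhd ℂ (fun t : ℂ => f (z + t • v)) ((fun t : ℂ => z + t • v) ⁻¹' U) :=
    (hf.comp hline.differentiableOn fun t ht => ht).analyticOnNhd hopen
  exact han.eqOn_zero_of_preconnected_of_frequently_eq_zero hconv.isPreconnected
    (show (0 : ℂ) ∈ _ by simpa using hz) h ht

end Identity

section Coordinates

variable {n : ℕ} {X : Type*} [NormedAddCommGroup X] [NormedSpace ℂ X] [CompleteSpace X]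

theorem star_mem_ball_star {m : ℕ} {x q : Fin m → ℂ} {r : ℝ} :
    star x ∈ ball (star q) r ↔ x ∈ ball q r := by
  rw [mem_ball, mem_ball, dist_eq_norm, dist_eq_norm, ← star_sub, norm_star]

theorem mem_ball_star {m : ℕ} {x q : Fin m → ℂ} {r : ℝ} :
    x ∈ ball (star q) r ↔ star x ∈ ball q r := by
  rw [← star_mem_ball_star, star_star]

/-- A function holomorphic in `x, y` that vanishes for `y = star x` vanishes (relative to the
hyperplanes where the first coordinate is zero). -/
theorem eq_zero_of_eq_zero_on_antidiagonal {q : Fin (n + 1) → ℂ} {r : ℝ}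
    {G : (Fin (n + 1) → ℂ) × (Fin (n + 1) → ℂ) → X}
    (hG : DifferentiableOn ℂ G (ball q r ×ˢ ball (star q) r))
    (h : ∀ x ∈ ball q r, x 0 = 0 → G (x, star x) = 0) {x y : Fin (n + 1) → ℂ}
    (hx : x ∈ ball q r) (hy : y ∈ ball (star q) r) (hx0 : x 0 = 0) (hy0 : y 0 = 0) :
    G (x, y) = 0 := by
  -- On the complex line t ↦ (α + tβ, star α + t star β), real t gives points of the antidiagonal
  -- and t = i gives (x, y). The zeros at small real t therefore propagate to t = i.
  obtain ⟨α, hα⟩ : ∃ α : Fin (n + 1) → ℂ, α = (2⁻¹ : ℝ) • x + (2⁻¹ : ℝ) • star y := ⟨_, rfl⟩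
  obtain ⟨β, hβ⟩ : ∃ β : Fin (n + 1) → ℂ, β = (-Complex.I / 2) • (x - star y) := ⟨_, rfl⟩
  have hαmem : α ∈ ball q r := by
    rw [hα]
    exact convex_ball q r hx (mem_ball_star.1 hy) (by norm_num) (by norm_num) (by norm_num)
  have hxy : (x, y) = (α, star α) + Complex.I • (β, star β) := by
    refine Prod.ext ?_ ?_
    · funext i
      simp only [hα, hβ, Prod.fst_add, Prod.smul_fst, Pi.add_apply, Pi.smul_apply, Pi.sub_apply,
        smul_eq_mul, Complex.real_smul, Pi.star_apply]
      push_cast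
      linear_combination ((1 / 2) * (x i - star (y i))) * Complex.I_mul_I
    · funext i
      simp only [hα, hβ, Prod.snd_add, Prod.smul_snd, Pi.add_apply, Pi.smul_apply, Pi.sub_apply,
        smul_eq_mul, Complex.real_smul, Pi.star_apply, Complex.star_def, map_add, map_mul,
        map_sub, map_neg,
        map_div₀, Complex.conj_I, map_ofNat, Complex.conj_ofReal, Complex.conj_conj]
      push_cast
      linear_combination (-(1 / 2) * ((starRingEnd ℂ) (x i) - y i)) * Complex.I_mul_I
  have hUo : IsOpen (ball q r ×ˢ ball (star q) r) := isOpen_ball.prod isOpen_ball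
  have hUc : Convex ℝ ((fun t : ℂ => (α, star α) + t • (β, star β)) ⁻¹'
      (ball q r ×ˢ ball (star q) r)) :=
    (convex_preimage_line (convex_ball q r) α β).inter
      (convex_preimage_line (convex_ball (star q) r) (star α) (star β))
  rw [hxy]
  refine eq_zero_of_frequently_line hUo hG hUc ⟨hαmem, star_mem_ball_star.2 hαmem⟩
    (by rw [← hxy]; exact ⟨hx, hy⟩) ?_
  have htend : Tendsto (fun t : ℝ => (t : ℂ)) (𝓝[≠] 0) (𝓝[≠] 0) := by
    refine tendsto_nhdsWithin_iff.2 ⟨?_, ?_⟩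
    · exact (Complex.continuous_ofReal.tendsto' 0 0 (by simp)).mono_left nhdsWithin_le_nhds
    · filter_upwards [self_mem_nhdsWithin] with t ht
      simpa using ht
  refine htend.frequently (Eventually.frequently ?_)
  have hcont : Continuous fun t : ℝ => α + (t : ℂ) • β := by fun_prop
  have hev : ∀ᶠ t : ℝ in 𝓝 0, α + (t : ℂ) • β ∈ ball q r :=
    hcont.continuousAt.eventually_mem (isOpen_ball.mem_nhds (by simpa using hαmem))
  filter_upwards [nhdsWithin_le_nhds hev] with t ht
  have h1 := h _ ht (by simp [hα, hβ, hx0, hy0])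
  convert h1 using 2
  refine Prod.ext rfl ?_
  funext i
  simp

end Coordinates

/-! ### Division by powers of the first coordinate. -/

section Division

variable {n : ℕ} {X : Type*} [NormedAddCommGroup X] [NormedSpace ℂ X]

/-- The first coordinate vector. -/
abbrev e₀ : Fin (n + 1) → ℂ := Pi.single 0 1

/-- The displaced point has first coordinate `t * x 0` and the others unchanged. Balls are polydiscs
for the supremum norm and the centre lies on the hyperplane, so the point stays inside. -/
theorem add_smul_mem_ball {q x : Fin (n + 1) → ℂ} {r : ℝ} (hq : q 0 = 0) (hx : x ∈ ball q r)
    {t : ℂ} (ht : ‖t‖ ≤ 1) : x + ((t - 1) * x 0) • e₀ ∈ ball q r := by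
  have hr : 0 < r := pos_of_mem_ball hx
  rw [mem_ball, dist_pi_lt_iff hr] at hx ⊢
  intro i
  refine Fin.cases ?_ (fun j => ?_) i
  · have h0 := hx 0
    rw [hq, dist_zero_right] at h0
    have : (x + ((t - 1) * x 0) • e₀ : Fin (n + 1) → ℂ) 0 = t * x 0 := by
      simp; ring
    rw [this, hq, dist_zero_right, norm_mul]
    exact (mul_le_of_le_one_left (norm_nonneg _) ht).trans_lt h0
  · simpa using hx j.succ

theorem dirDeriv_coord (x : Fin (n + 1) → ℂ) :
    dirDeriv e₀ (fun x : Fin (n + 1) → ℂ => x 0) x = 1 := by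
  have h : HasFDerivAt (fun x : Fin (n + 1) → ℂ => x 0)
      (ContinuousLinearMap.proj (R := ℂ) (φ := fun _ : Fin (n + 1) => ℂ) 0) x :=
    (ContinuousLinearMap.proj (R := ℂ) (φ := fun _ : Fin (n + 1) => ℂ) 0).hasFDerivAt
  unfold dirDeriv
  rw [h.fderiv]
  simp

variable [CompleteSpace X]

theorem iterate_dirDeriv_succ_coord_smul {U : Set (Fin (n + 1) → ℂ)} (hU : IsOpen U)
    {g : (Fin (n + 1) → ℂ) → X} (hg : DifferentiableOn ℂ g U) (a : ℕ) :
    EqOn ((dirDeriv e₀)^[a + 1] fun x => x 0 • g x)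
      (fun x => x 0 • (dirDeriv e₀)^[a + 1] g x + (a + 1 : ℂ) • (dirDeriv e₀)^[a] g x) U := by
  have hc : DifferentiableOn ℂ (fun x : Fin (n + 1) → ℂ => x 0) U := by fun_prop
  induction a generalizing g with
  | zero =>
    intro x hx
    refine (iterate_dirDeriv_succ_smul hU hc hg 0 hx).trans ?_
    simp [dirDeriv_coord, add_comm]
  | succ a ih =>
    intro x hx
    rw [iterate_dirDeriv_succ_smul hU hc hg (a + 1) hx]
    have := ih (differentiableOn_dirDeriv hU hg e₀) hx
    simp only [dirDeriv_coord, one_smul]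
    rw [this]
    simp only [Function.iterate_succ_apply, Nat.cast_add, Nat.cast_one, add_smul, one_smul]
    abel

theorem iterate_dirDeriv_coord_pow_smul {U : Set (Fin (n + 1) → ℂ)} (hU : IsOpen U)
    {g : (Fin (n + 1) → ℂ) → X} (hg : DifferentiableOn ℂ g U) {a k : ℕ} (ha : a < k)
    {x : Fin (n + 1) → ℂ} (hx : x ∈ U) (hx0 : x 0 = 0) :
    (dirDeriv e₀)^[a] (fun x => x 0 ^ k • g x) x = 0 := by
  induction k generalizing a with
  | zero => omega
  | succ k ih =>
    have e : (fun x : Fin (n + 1) → ℂ => x 0 ^ (k + 1) • g x) =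
        fun x => x 0 • (x 0 ^ k • g x) := by
      funext x; rw [smul_smul, pow_succ']
    rw [e]
    cases a with
    | zero => simp [hx0]
    | succ a =>
      have hd : DifferentiableOn ℂ (fun x : Fin (n + 1) → ℂ => x 0 ^ k • g x) U :=
        DifferentiableOn.smul (by fun_prop) hg
      rw [iterate_dirDeriv_succ_coord_smul hU hd a hx]
      simp [hx0, ih (Nat.lt_of_succ_lt_succ ha)]

/-- Hadamard's lemma: the quotient is the integral over t from 0 to 1 of the first partial
derivative at the point whose first coordinate is multiplied by t. -/
theorem exists_eq_coord_smul {q : Fin (n + 1) → ℂ} {r : ℝ} (hq : q 0 = 0)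
    {f : (Fin (n + 1) → ℂ) → X} (hf : DifferentiableOn ℂ f (ball q r))
    (h : ∀ x ∈ ball q r, x 0 = 0 → f x = 0) :
    ∃ g : (Fin (n + 1) → ℂ) → X, DifferentiableOn ℂ g (ball q r) ∧
      ∀ x ∈ ball q r, f x = x 0 • g x := by
  have hD := differentiableOn_dirDeriv isOpen_ball hf e₀
  have hnorm : ∀ t ∈ Icc (0 : ℝ) 1, ‖(t : ℂ)‖ ≤ 1 := fun t ht => by
    rw [Complex.norm_real, Real.norm_eq_abs, abs_of_nonneg ht.1]; exact ht.2
  refine ⟨fun x => ∫ t in (0 : ℝ)..1, dirDeriv e₀ f (x + (((t : ℂ) - 1) * x 0) • e₀), ?_, ?_⟩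
  · refine differentiableOn_intervalIntegral isOpen_ball zero_le_one (fun t ht => ?_) ?_
    · exact hD.comp (by fun_prop) fun x hx => add_smul_mem_ball hq hx (hnorm t ht)
    · refine hD.continuousOn.comp (f := fun p : (Fin (n + 1) → ℂ) × ℝ =>
        p.1 + (((p.2 : ℂ) - 1) * p.1 0) • e₀) (Continuous.continuousOn (by fun_prop)) ?_
      exact fun p hp => add_smul_mem_ball hq hp.1 (hnorm p.2 hp.2)
  · intro x hx
    have hderiv : ∀ t ∈ Set.uIcc (0 : ℝ) 1,
        HasDerivAt (fun t : ℝ => f (x + (((t : ℂ) - 1) * x 0) • e₀))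
          (x 0 • dirDeriv e₀ f (x + (((t : ℂ) - 1) * x 0) • e₀)) t := fun t ht => by
      rw [uIcc_of_le zero_le_one] at ht
      have hm := add_smul_mem_ball hq hx (hnorm t ht)
      have h1 : HasDerivAt (fun t : ℂ => x + ((t - 1) * x 0) • e₀) (x 0 • e₀) (t : ℂ) := by
        simpa using ((((hasDerivAt_id (t : ℂ)).sub_const 1).mul_const (x 0)).smul_const
          (e₀ : Fin (n + 1) → ℂ)).const_add x
      have h2 := ((hf.differentiableAt (isOpen_ball.mem_nhds hm)).hasFDerivAt.comp_hasDerivAt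
        (t : ℂ) h1).scomp t Complex.ofRealCLM.hasDerivAt
      rw [map_smul] at h2
      simpa using! h2
    have hcont : ContinuousOn (fun t : ℝ =>
        dirDeriv e₀ f (x + (((t : ℂ) - 1) * x 0) • e₀)) (Icc 0 1) :=
      hD.continuousOn.comp (Continuous.continuousOn (by fun_prop))
        fun t ht => add_smul_mem_ball hq hx (hnorm t ht)
    have hint := intervalIntegral.integral_eq_sub_of_hasDerivAt hderiv
      (ContinuousOn.intervalIntegrable (by
        rw [uIcc_of_le zero_le_one]; exact hcont.const_smul (x 0)))
    rw [intervalIntegral.integral_smul] at hint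
    rw [hint]
    have hz := h _ (add_smul_mem_ball hq hx (t := ((0 : ℝ) : ℂ)) (by simp)) (by simp)
    rw [hz]
    simp

/-- Divide once and repeat: on the hyperplane ∂₀^(a+1)(x₀g) = (a+1)∂₀^a g, so the quotient inherits
the vanishing with one order less. -/
theorem exists_eq_coord_pow_smul {q : Fin (n + 1) → ℂ} {r : ℝ} (hq : q 0 = 0) (k : ℕ)
    {f : (Fin (n + 1) → ℂ) → X} (hf : DifferentiableOn ℂ f (ball q r))
    (h : ∀ a < k, ∀ x ∈ ball q r, x 0 = 0 → (dirDeriv e₀)^[a] f x = 0) :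
    ∃ g : (Fin (n + 1) → ℂ) → X, DifferentiableOn ℂ g (ball q r) ∧
      ∀ x ∈ ball q r, f x = x 0 ^ k • g x := by
  induction k generalizing f with
  | zero => exact ⟨f, hf, fun x _ => by simp⟩
  | succ k ih =>
    obtain ⟨g₁, hg₁, e₁⟩ := exists_eq_coord_smul hq hf fun x hx hx0 => h 0 (by omega) x hx hx0
    obtain ⟨g, hg, e⟩ := ih hg₁ fun a ha x hx hx0 => by
      have h1 := h (a + 1) (by omega) x hx hx0
      rw [iterate_dirDeriv_congr isOpen_ball e₁ (a + 1) hx,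
        iterate_dirDeriv_succ_coord_smul isOpen_ball hg₁ a hx] at h1
      simp only [hx0, zero_smul, zero_add] at h1
      exact (smul_eq_zero.1 h1).resolve_left (Nat.cast_add_one_ne_zero a)
    exact ⟨g, hg, fun x hx => by rw [e₁ x hx, e x hx, smul_smul, pow_succ']⟩

/-- The derivatives of a holomorphic function along a hyperplane slice of a polydisc vanish as soon
as they vanish near one point of the slice. -/
theorem eq_zero_on_slice {q : Fin (n + 1) → ℂ} {r : ℝ} {f : (Fin (n + 1) → ℂ) → X}
    (hf : DifferentiableOn ℂ f (ball q r)) {x₁ x₂ : Fin (n + 1) → ℂ} (hx₁ : x₁ ∈ ball q r)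
    (hx₂ : x₂ ∈ ball q r) (h₁ : x₁ 0 = 0) (h₂ : x₂ 0 = 0)
    (h : ∀ᶠ x in 𝓝 x₁, x 0 = 0 → f x = 0) : f x₂ = 0 := by
  have hx : x₂ = x₁ + (1 : ℂ) • (x₂ - x₁) := by simp
  rw [hx]
  refine eq_zero_of_frequently_line isOpen_ball hf (convex_preimage_line (convex_ball q r) _ _)
    hx₁ (by rwa [← hx]) (Eventually.frequently (nhdsWithin_le_nhds ?_))
  have hc : Tendsto (fun t : ℂ => x₁ + t • (x₂ - x₁)) (𝓝 0) (𝓝 x₁) :=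
    Continuous.tendsto' (by fun_prop) _ _ (by simp)
  filter_upwards [hc.eventually h] with t ht
  exact ht (by simp [h₁, h₂])

end Division

/-! ### Pairings that are holomorphic in two independent variables. -/

section Pairing

variable {n m : ℕ} {H : Type*} [NormedAddCommGroup H] [InnerProductSpace ℂ H]

/-- The holomorphic family of functionals `x ↦ ⟪S (star x), ·⟫`. -/
def conjDual (S : (Fin m → ℂ) → H) : (Fin m → ℂ) → H →L[ℂ] ℂ := fun x => innerSL ℂ (S (star x))

theorem conjDual_apply (S : (Fin m → ℂ) → H) (x : Fin m → ℂ) (h : H) :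
    conjDual S x h = ⟪S (star x), h⟫_ℂ := rfl

/-- The conjugation `star` and the antilinearity of the inner product in its first slot cancel,
which makes the derivative complex linear. -/
theorem hasFDerivAt_conjDual {S : (Fin m → ℂ) → H} {x : Fin m → ℂ}
    (hS : DifferentiableAt ℂ S (star x)) :
    HasFDerivAt (conjDual S) ((innerSL ℂ (E := H)).comp ((fderiv ℂ S (star x)).comp
      (starL ℂ : (Fin m → ℂ) ≃L⋆[ℂ] (Fin m → ℂ)).toContinuousLinearMap)) x :=
  .comp_semilinear (innerSL ℂ (E := H))
    (starL ℂ : (Fin m → ℂ) ≃L⋆[ℂ] (Fin m → ℂ)).toContinuousLinearMap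
    (by simpa using hS.hasFDerivAt)

theorem differentiableOn_conjDual {S : (Fin m → ℂ) → H} {q : Fin m → ℂ} {r : ℝ}
    (hS : DifferentiableOn ℂ S (ball (star q) r)) :
    DifferentiableOn ℂ (conjDual S) (ball q r) := fun _ hx =>
  (hasFDerivAt_conjDual (hS.differentiableAt (isOpen_ball.mem_nhds
    (star_mem_ball_star.2 hx)))).differentiableAt.differentiableWithinAt

theorem dirDeriv_conjDual {S : (Fin m → ℂ) → H} {q v : Fin m → ℂ} {r : ℝ}
    (hS : DifferentiableOn ℂ S (ball (star q) r)) :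
    EqOn (dirDeriv v (conjDual S)) (conjDual (dirDeriv (star v) S)) (ball q r) := fun x hx => by
  unfold dirDeriv
  rw [(hasFDerivAt_conjDual (hS.differentiableAt (isOpen_ball.mem_nhds
    (star_mem_ball_star.2 hx)))).fderiv]
  rfl

theorem iterate_dirDeriv_conjDual [CompleteSpace H] {S : (Fin m → ℂ) → H} {q v : Fin m → ℂ}
    {r : ℝ} (hS : DifferentiableOn ℂ S (ball (star q) r)) (a : ℕ) :
    EqOn ((dirDeriv v)^[a] (conjDual S)) (conjDual ((dirDeriv (star v))^[a] S)) (ball q r) := by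
  induction a generalizing S with
  | zero => exact fun z _ => rfl
  | succ a ih =>
    exact (iterate_dirDeriv_congr isOpen_ball (dirDeriv_conjDual hS) a).trans
      (ih (differentiableOn_dirDeriv isOpen_ball hS _))

variable {E E' X : Type*} [NormedAddCommGroup E] [NormedSpace ℂ E] [NormedAddCommGroup E']
  [NormedSpace ℂ E'] [NormedAddCommGroup X] [NormedSpace ℂ X]

theorem differentiableOn_pairing {A : E → X →L[ℂ] ℂ} {T : E' → X} {U : Set E} {U' : Set E'}
    (hA : DifferentiableOn ℂ A U) (hT : DifferentiableOn ℂ T U') :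
    DifferentiableOn ℂ (fun p : E × E' => A p.1 (T p.2)) (U ×ˢ U') :=
  (hA.comp differentiableOn_fst fun _ hp => hp.1).clm_apply
    (hT.comp differentiableOn_snd fun _ hp => hp.2)

theorem dirDeriv_pairing_fst {A : E → X →L[ℂ] ℂ} {T : E' → X} {U : Set E} {U' : Set E'}
    (hU : IsOpen U) (hU' : IsOpen U') (hA : DifferentiableOn ℂ A U)
    (hT : DifferentiableOn ℂ T U') (v : E) :
    EqOn (dirDeriv ((v, 0) : E × E') fun p : E × E' => A p.1 (T p.2))
      (fun p => dirDeriv v A p.1 (T p.2)) (U ×ˢ U') := fun p hp => by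
  have h1 := (hA.differentiableAt (hU.mem_nhds hp.1)).hasFDerivAt.comp p
    (hasFDerivAt_fst (𝕜 := ℂ) (p := p))
  have h2 := (hT.differentiableAt (hU'.mem_nhds hp.2)).hasFDerivAt.comp p
    (hasFDerivAt_snd (𝕜 := ℂ) (p := p))
  have h := (h1.clm_apply h2).fderiv
  unfold dirDeriv
  simp only [Function.comp_def] at h
  rw [h]
  simp

theorem dirDeriv_pairing_snd {A : E → X →L[ℂ] ℂ} {T : E' → X} {U : Set E} {U' : Set E'}
    (hU : IsOpen U) (hU' : IsOpen U') (hA : DifferentiableOn ℂ A U)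
    (hT : DifferentiableOn ℂ T U') (v : E') :
    EqOn (dirDeriv ((0, v) : E × E') fun p : E × E' => A p.1 (T p.2))
      (fun p => A p.1 (dirDeriv v T p.2)) (U ×ˢ U') := fun p hp => by
  have h1 := (hA.differentiableAt (hU.mem_nhds hp.1)).hasFDerivAt.comp p
    (hasFDerivAt_fst (𝕜 := ℂ) (p := p))
  have h2 := (hT.differentiableAt (hU'.mem_nhds hp.2)).hasFDerivAt.comp p
    (hasFDerivAt_snd (𝕜 := ℂ) (p := p))
  have h := (h1.clm_apply h2).fderiv
  unfold dirDeriv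
  simp only [Function.comp_def] at h
  rw [h]
  simp

theorem iterate_dirDeriv_pairing [CompleteSpace X] [FiniteDimensional ℂ E]
    [FiniteDimensional ℂ E'] {A : E → X →L[ℂ] ℂ} {T : E' → X} {U : Set E} {U' : Set E'}
    (hU : IsOpen U) (hU' : IsOpen U') (hA : DifferentiableOn ℂ A U)
    (hT : DifferentiableOn ℂ T U') (v : E) (w : E') (a b : ℕ) :
    EqOn ((dirDeriv ((0, w) : E × E'))^[b] ((dirDeriv ((v, 0) : E × E'))^[a]
      fun p : E × E' => A p.1 (T p.2)))
      (fun p => (dirDeriv v)^[a] A p.1 ((dirDeriv w)^[b] T p.2)) (U ×ˢ U') := by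
  induction a generalizing A with
  | zero =>
    induction b generalizing T with
    | zero => exact fun p _ => rfl
    | succ b ih =>
      exact (iterate_dirDeriv_congr (hU.prod hU') (dirDeriv_pairing_snd hU hU' hA hT w) b).trans
        (ih (differentiableOn_dirDeriv hU' hT w))
  | succ a ih =>
    exact (iterate_dirDeriv_congr (hU.prod hU') (iterate_dirDeriv_congr (hU.prod hU')
      (dirDeriv_pairing_fst hU hU' hA hT v) a) b).trans
      (ih (differentiableOn_dirDeriv hU hA v))

end Pairing

/-! ### Wirtinger derivatives read off from the polarisation. -/

section Wirtinger

variable {m : ℕ}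

/-- The restriction of a function of `x, y` to `y = star x`. -/
def antidiag (Φ : (Fin m → ℂ) × (Fin m → ℂ) → ℂ) : (Fin m → ℂ) → ℂ := fun x => Φ (x, star x)

theorem fderiv_antidiag {Φ : (Fin m → ℂ) × (Fin m → ℂ) → ℂ} {x : Fin m → ℂ}
    (h : DifferentiableAt ℂ Φ (x, star x)) (v : Fin m → ℂ) :
    fderiv ℝ (antidiag Φ) x v = fderiv ℂ Φ (x, star x) (v, star v) := by
  have h1 : HasFDerivAt (fun x : Fin m → ℂ => (x, star x))
      ((ContinuousLinearMap.id ℝ (Fin m → ℂ)).prod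
        ((starL' ℝ : (Fin m → ℂ) ≃L[ℝ] (Fin m → ℂ)) : (Fin m → ℂ) →L[ℝ] (Fin m → ℂ))) x :=
    (hasFDerivAt_id x).prodMk (starL' ℝ : (Fin m → ℂ) ≃L[ℝ] (Fin m → ℂ)).hasFDerivAt
  have h2 := (h.hasFDerivAt.restrictScalars ℝ).comp x h1
  have h3 : fderiv ℝ (antidiag Φ) x = _ := h2.fderiv
  rw [h3]
  rfl

theorem star_single_one (j : Fin m) : star (Pi.single j 1 : Fin m → ℂ) = Pi.single j 1 := by
  rw [← Pi.single_star, star_one]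

theorem fderiv_antidiag_one_I {Φ : (Fin m → ℂ) × (Fin m → ℂ) → ℂ} {x : Fin m → ℂ}
    (h : DifferentiableAt ℂ Φ (x, star x)) (j : Fin m) :
    fderiv ℝ (antidiag Φ) x (Pi.single j 1) =
        dirDeriv (Pi.single j 1, 0) Φ (x, star x) + dirDeriv (0, Pi.single j 1) Φ (x, star x) ∧
      fderiv ℝ (antidiag Φ) x (Pi.single j Complex.I) =
        Complex.I * dirDeriv (Pi.single j 1, 0) Φ (x, star x) -
          Complex.I * dirDeriv (0, Pi.single j 1) Φ (x, star x) := by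
  rw [fderiv_antidiag h, fderiv_antidiag h]
  unfold dirDeriv
  rw [← map_add, ← smul_eq_mul, ← smul_eq_mul, ← map_smul, ← map_smul, ← map_sub]
  have hI : (Pi.single j Complex.I : Fin m → ℂ) = Complex.I • Pi.single j 1 := by
    rw [← Pi.single_smul, smul_eq_mul, mul_one]
  constructor
  · simp
  · rw [hI, star_smul, star_single_one]
    simp

/-- Along y = x̄ the direction v moves (x, y) by (v, v̄), so the part in y cancels in ∂_j, and the
part in x cancels in ∂̄_j. This turns 𝒟_k into holomorphic derivatives in independent variables. -/
theorem del_antidiag {Φ : (Fin m → ℂ) × (Fin m → ℂ) → ℂ} {x : Fin m → ℂ}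
    (h : DifferentiableAt ℂ Φ (x, star x)) (j : Fin m) :
    del j (antidiag Φ) x = antidiag (dirDeriv (Pi.single j 1, 0) Φ) x := by
  obtain ⟨h1, h2⟩ := fderiv_antidiag_one_I h j
  unfold del
  rw [h1, h2]
  unfold antidiag
  linear_combination (-(1 / 2) * dirDeriv (Pi.single j 1, 0) Φ (x, star x) +
    (1 / 2) * dirDeriv (0, Pi.single j 1) Φ (x, star x)) * Complex.I_mul_I

theorem delBar_antidiag {Φ : (Fin m → ℂ) × (Fin m → ℂ) → ℂ} {x : Fin m → ℂ}
    (h : DifferentiableAt ℂ Φ (x, star x)) (j : Fin m) :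
    delBar j (antidiag Φ) x = antidiag (dirDeriv (0, Pi.single j 1) Φ) x := by
  obtain ⟨h1, h2⟩ := fderiv_antidiag_one_I h j
  unfold delBar
  rw [h1, h2]
  unfold antidiag
  linear_combination ((1 / 2) * dirDeriv (Pi.single j 1, 0) Φ (x, star x) -
    (1 / 2) * dirDeriv (0, Pi.single j 1) Φ (x, star x)) * Complex.I_mul_I

theorem del_congr {U : Set (Fin m → ℂ)} (hU : IsOpen U) {F G : (Fin m → ℂ) → ℂ}
    (h : EqOn F G U) (j : Fin m) : EqOn (del j F) (del j G) U := fun z hz => by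
  unfold del
  rw [Filter.EventuallyEq.fderiv_eq (h.eventuallyEq_of_mem (hU.mem_nhds hz))]

theorem delBar_congr {U : Set (Fin m → ℂ)} (hU : IsOpen U) {F G : (Fin m → ℂ) → ℂ}
    (h : EqOn F G U) (j : Fin m) : EqOn (delBar j F) (delBar j G) U := fun z hz => by
  unfold delBar
  rw [Filter.EventuallyEq.fderiv_eq (h.eventuallyEq_of_mem (hU.mem_nhds hz))]

theorem iterate_del_antidiag {q : Fin m → ℂ} {r : ℝ} {F : (Fin m → ℂ) → ℂ}
    {Φ : (Fin m → ℂ) × (Fin m → ℂ) → ℂ} (hΦ : DifferentiableOn ℂ Φ (ball q r ×ˢ ball (star q) r))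
    (h : EqOn F (antidiag Φ) (ball q r)) (j : Fin m) (a : ℕ) :
    EqOn ((del j)^[a] F) (antidiag ((dirDeriv (Pi.single j 1, 0))^[a] Φ)) (ball q r) := by
  induction a generalizing F Φ with
  | zero => exact h
  | succ a ih =>
    refine ih (differentiableOn_dirDeriv (isOpen_ball.prod isOpen_ball) hΦ _) ?_
    exact (del_congr isOpen_ball h j).trans fun _ hx => del_antidiag
      (hΦ.differentiableAt ((isOpen_ball.prod isOpen_ball).mem_nhds
        ⟨hx, star_mem_ball_star.2 hx⟩)) j

theorem iterate_delBar_antidiag {q : Fin m → ℂ} {r : ℝ} {F : (Fin m → ℂ) → ℂ}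
    {Φ : (Fin m → ℂ) × (Fin m → ℂ) → ℂ} (hΦ : DifferentiableOn ℂ Φ (ball q r ×ˢ ball (star q) r))
    (h : EqOn F (antidiag Φ) (ball q r)) (j : Fin m) (a : ℕ) :
    EqOn ((delBar j)^[a] F) (antidiag ((dirDeriv (0, Pi.single j 1))^[a] Φ)) (ball q r) := by
  induction a generalizing F Φ with
  | zero => exact h
  | succ a ih =>
    refine ih (differentiableOn_dirDeriv (isOpen_ball.prod isOpen_ball) hΦ _) ?_
    exact (delBar_congr isOpen_ball h j).trans fun _ hx => delBar_antidiag
      (hΦ.differentiableAt ((isOpen_ball.prod isOpen_ball).mem_nhds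
        ⟨hx, star_mem_ball_star.2 hx⟩)) j

end Wirtinger

/-! ### Elements of the module as holomorphic functions, and the fibres of its bundle. -/

section Module

namespace QuasiFreeModule

variable {m : ℕ} {Ω : Set (Fin m → ℂ)} {H : Type*} [NormedAddCommGroup H]
    [InnerProductSpace ℂ H] [CompleteSpace H] (M : QuasiFreeModule Ω H)

theorem toFun_of_mem (h : H) {w : Fin m → ℂ} (hw : w ∈ Ω) : M.toFun h w = M.eval ⟨w, hw⟩ h := by
  simp [toFun, hw]

theorem inner_kernelVec (w : Ω) (h : H) : ⟪M.kernelVec w, h⟫_ℂ = M.eval w h := by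
  simp [kernelVec]

theorem eval_act (f : funAlg Ω) (w : Ω) (h : H) :
    M.eval w (M.act f h) = evalAlg w f * M.eval w h := by
  have := M.denseRange_incl.equalizer (g := fun h => M.eval w (M.act f h))
    (h := fun h => evalAlg w f * M.eval w h) (by fun_prop) (by fun_prop) (by
      funext g
      simp only [Function.comp_apply, act_incl, eval_incl]
      rfl)
  exact congrFun this h

/-- The constant function `1`. -/
def one : H := M.incl 1

theorem eval_one (w : Ω) : M.eval w M.one = 1 := by
  rw [one, eval_incl]; rfl

theorem act_one (f : funAlg Ω) : M.act f M.one = M.incl f := by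
  rw [one, act_incl, mul_one]

theorem toFun_act (f : funAlg Ω) (h : H) (w : Fin m → ℂ) :
    M.toFun (M.act f h) w = M.toFun (M.incl f) w * M.toFun h w := by
  by_cases hw : w ∈ Ω
  · rw [toFun_of_mem _ _ hw, toFun_of_mem _ _ hw, toFun_of_mem _ _ hw, eval_act, eval_incl]
  · simp [toFun, hw]

variable {M}

/-- The function 1 takes the value 1 at `w`, so pairing with it reads off the coefficient of the
kernel vector. -/
theorem eq_inner_one_smul_kernelVec {w : Ω} {v : H}
    (hv : v ∈ Submodule.span ℂ {M.kernelVec w}) : v = ⟪M.one, v⟫_ℂ • M.kernelVec w := by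
  obtain ⟨c, rfl⟩ := Submodule.mem_span_singleton.1 hv
  rw [inner_smul_right, ← inner_conj_symm, inner_kernelVec, eval_one]
  simp

theorem inner_one_ne_zero {w : Ω} {v : H} (hv : v ∈ Submodule.span ℂ {M.kernelVec w})
    (h0 : v ≠ 0) : ⟪M.one, v⟫_ℂ ≠ 0 := fun h => h0 <| by
  rw [eq_inner_one_smul_kernelVec hv, h, zero_smul]

theorem inner_eq_of_mem_fibre {w : Ω} {v : H} (hv : v ∈ Submodule.span ℂ {M.kernelVec w})
    (h : H) : ⟪h, v⟫_ℂ = ⟪M.one, v⟫_ℂ * star (M.eval w h) := by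
  conv_lhs => rw [eq_inner_one_smul_kernelVec hv]
  rw [inner_smul_right, ← inner_conj_symm h, inner_kernelVec]
  rfl

/-- Vectors of the fibre are joint eigenvectors of the adjoints of the module action. -/
theorem inner_act_of_mem_fibre {w : Ω} {v : H} (hv : v ∈ Submodule.span ℂ {M.kernelVec w})
    (f : funAlg Ω) (h : H) : ⟪M.act f h, v⟫_ℂ = star (evalAlg w f) * ⟪h, v⟫_ℂ := by
  rw [inner_eq_of_mem_fibre hv (M.act f h), inner_eq_of_mem_fibre hv h, eval_act, star_mul']
  ring

/-- A module that admits a holomorphic frame consists of holomorphic functions. -/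
theorem IsFrame.differentiableOn_toFun {s : (Fin m → ℂ) → H} (hs : M.IsFrame s) (hΩ : IsOpen Ω)
    (h : H) : DifferentiableOn ℂ (M.toFun h) Ω := by
  have hopen : IsOpen {v : Fin m → ℂ | star v ∈ Ω} := hΩ.preimage continuous_star
  intro w hw
  have hd : DifferentiableAt ℂ s (star w) :=
    hs.differentiableOn.differentiableAt (hopen.mem_nhds (by simpa using hw))
  have hin : ∀ h : H, DifferentiableAt ℂ (fun v => ⟪h, s v⟫_ℂ) (star w) := fun h =>
    (innerSL ℂ h).hasFDerivAt.differentiableAt.comp (star w) hd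
  -- At `star z` this quotient is the conjugate of h(z), whatever the normalisation of the frame.
  have hG : DifferentiableAt ℂ (fun v => ⟪h, s v⟫_ℂ / ⟪M.one, s v⟫_ℂ) (star w) := by
    simp only [div_eq_mul_inv]
    refine (hin h).fun_mul ((hin M.one).fun_inv ?_)
    exact inner_one_ne_zero (hs.mem_fibre ⟨w, hw⟩) (hs.ne_zero ⟨w, hw⟩)
  have := hG.star_star
  rw [star_star] at this
  refine (this.congr_of_eventuallyEq ?_).differentiableWithinAt
  filter_upwards [hΩ.mem_nhds hw] with z hz
  have h1 := hs.mem_fibre ⟨z, hz⟩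
  have h2 := inner_one_ne_zero h1 (hs.ne_zero ⟨z, hz⟩)
  simp only [Function.comp_apply]
  rw [inner_eq_of_mem_fibre h1 h, mul_div_cancel_left₀ _ h2, star_star, toFun_of_mem _ _ hz]

theorem IsFrame.act_mem_vanishing {s : (Fin m → ℂ) → H} (hs : M.IsFrame s) (hΩ : IsOpen Ω)
    {Z : Set (Fin m → ℂ)} (hZ : Z ⊆ Ω) {k : ℕ} (f : funAlg Ω) {h : H}
    (hh : h ∈ M.vanishing Z k) : M.act f h ∈ M.vanishing Z k := by
  intro p hp U φ hpU hφ
  obtain ⟨V, hVU, hpV, hV, g, hg, e⟩ := hh p hp U φ hpU hφ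
  refine ⟨V ∩ Ω, inter_subset_left.trans hVU, ⟨hpV, hZ hp⟩, hV.inter hΩ,
    fun z => M.toFun (M.incl f) z * g z, ?_, fun z hz => ?_⟩
  · exact ((hs.differentiableOn_toFun hΩ _).mono inter_subset_right).mul
      (hg.mono inter_subset_left)
  · rw [toFun_act, e z hz.1]
    ring

/-- The orthogonal complement of the quotient is the closure of ℳ₀, and invariance passes to the
closure by continuity. Closedness of ℳ₀ itself plays no role. -/
theorem IsFrame.act_mem_orthogonal_quotient {s : (Fin m → ℂ) → H} (hs : M.IsFrame s)
    (hΩ : IsOpen Ω) {Z : Set (Fin m → ℂ)} (hZ : Z ⊆ Ω) {k : ℕ} (f : funAlg Ω) {h : H}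
    (hh : h ∈ (M.quotient Z k)ᗮ) : M.act f h ∈ (M.quotient Z k)ᗮ := by
  rw [quotient, Submodule.orthogonal_orthogonal_eq_closure, ← SetLike.mem_coe,
    Submodule.topologicalClosure_coe] at hh ⊢
  exact map_mem_closure (M.act f).continuous hh fun x hx => hs.act_mem_vanishing hΩ hZ f hx

end QuasiFreeModule

end Module

/-! ### Order of vanishing in adapted charts. -/

section Vanishing

variable {n k : ℕ} {Ω Z : Set (Fin (n + 1) → ℂ)}
  {e : OpenPartialHomeomorph (Fin (n + 1) → ℂ) (Fin (n + 1) → ℂ)}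

/-- `f` vanishes to order `k` on `Z` near the point `p`. -/
def VanishesAt (Z : Set (Fin (n + 1) → ℂ)) (k : ℕ) (f : (Fin (n + 1) → ℂ) → ℂ)
    (p : Fin (n + 1) → ℂ) : Prop :=
  ∀ U φ, p ∈ U → IsLocalDefiningFunction Z U φ →
    ∃ V ⊆ U, p ∈ V ∧ IsOpen V ∧ ∃ g, DifferentiableOn ℂ g V ∧ ∀ z ∈ V, f z = φ z ^ k * g z

theorem IsAdaptedChart.symm_mem_iff (he : IsAdaptedChart Ω Z e) {x : Fin (n + 1) → ℂ}
    (hx : x ∈ e.target) : e.symm x ∈ Z ↔ x 0 = 0 := by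
  rw [he.mem_iff _ (e.map_target hx), e.right_inv hx]

theorem IsAdaptedChart.symm_mem (he : IsAdaptedChart Ω Z e) {x : Fin (n + 1) → ℂ}
    (hx : x ∈ e.target) : e.symm x ∈ Ω := he.source_subset (e.map_target hx)

theorem IsAdaptedChart.isLocalDefiningFunction (he : IsAdaptedChart Ω Z e) :
    IsLocalDefiningFunction Z e.source fun z => e z 0 where
  isOpen := e.open_source
  differentiableOn := differentiableOn_pi.1 he.differentiableOn 0
  mem_iff := he.mem_iff
  fderiv_ne_zero := by
    rintro z ⟨hz, -⟩ h0
    have h1 : DifferentiableAt ℂ (fun z => e z 0) (e.symm (e z)) := by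
      rw [e.left_inv hz]
      exact (differentiableOn_pi.1 he.differentiableOn 0).differentiableAt
        (e.open_source.mem_nhds hz)
    have h2 := h1.hasFDerivAt.comp (e z) (he.differentiableOn_symm.differentiableAt
      (e.open_target.mem_nhds (e.map_source hz))).hasFDerivAt
    rw [e.left_inv hz, h0, ContinuousLinearMap.zero_comp] at h2
    have h3 : HasFDerivAt (fun x : Fin (n + 1) → ℂ => x 0) (0 : (Fin (n + 1) → ℂ) →L[ℂ] ℂ)
        (e z) := by
      refine h2.congr_of_eventuallyEq ?_
      filter_upwards [e.open_target.mem_nhds (e.map_source hz)] with x hx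
      simp [e.right_inv hx]
    have h4 := dirDeriv_coord (e z)
    rw [dirDeriv, h3.fderiv] at h4
    simp at h4

theorem VanishesAt.eventually_iterate_dirDeriv_eq_zero (he : IsAdaptedChart Ω Z e)
    {f : (Fin (n + 1) → ℂ) → ℂ} {x₁ : Fin (n + 1) → ℂ} (hx₁ : x₁ ∈ e.target)
    (h : VanishesAt Z k f (e.symm x₁)) :
    ∀ᶠ x in 𝓝 x₁, x 0 = 0 → ∀ a < k, (dirDeriv e₀)^[a] (fun x => f (e.symm x)) x = 0 := by
  obtain ⟨V, hVs, hpV, hV, g, hg, hfg⟩ :=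
    h e.source _ (e.map_target hx₁) he.isLocalDefiningFunction
  have hW : IsOpen (e.target ∩ e.symm ⁻¹' V) := e.isOpen_inter_preimage_symm hV
  filter_upwards [hW.mem_nhds ⟨hx₁, hpV⟩] with x hx hx0 a ha
  have heq : EqOn (fun x => f (e.symm x)) (fun x => x 0 ^ k • g (e.symm x))
      (e.target ∩ e.symm ⁻¹' V) := fun x hx => by
    simp only
    rw [hfg _ hx.2, e.right_inv hx.1, smul_eq_mul]
  rw [iterate_dirDeriv_congr hW heq a hx]
  exact iterate_dirDeriv_coord_pow_smul hW (hg.comp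
    (he.differentiableOn_symm.mono inter_subset_left) fun x hx => hx.2) ha hx hx0

/-- In the chart f is x₀^k g by division, and any defining function φ is x₀u with u(q) ≠ 0 because
dφ ≠ 0. Hence f = φ^k · g/u^k near the point. -/
theorem vanishesAt_of_iterate_dirDeriv_eq_zero (he : IsAdaptedChart Ω Z e)
    {f : (Fin (n + 1) → ℂ) → ℂ} {q : Fin (n + 1) → ℂ} {r : ℝ} (hr : 0 < r) (hq : q 0 = 0)
    (hball : ball q r ⊆ e.target)
    (hf : DifferentiableOn ℂ (fun x => f (e.symm x)) (ball q r))
    (h : ∀ a < k, ∀ x ∈ ball q r, x 0 = 0 → (dirDeriv e₀)^[a] (fun x => f (e.symm x)) x = 0) :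
    VanishesAt Z k f (e.symm q) := by
  intro U φ hpU hφ
  have hqt : q ∈ e.target := hball (mem_ball_self hr)
  obtain ⟨g, hg, hfg⟩ := exists_eq_coord_pow_smul hq k hf h
  have hW : IsOpen (ball q r ∩ (e.target ∩ e.symm ⁻¹' U)) :=
    isOpen_ball.inter (e.isOpen_inter_preimage_symm hφ.isOpen)
  obtain ⟨δ, hδ, hδW⟩ := Metric.isOpen_iff.1 hW q ⟨mem_ball_self hr, hqt, hpU⟩
  have hφd : DifferentiableOn ℂ (fun x => φ (e.symm x)) (ball q δ) :=
    hφ.differentiableOn.comp (he.differentiableOn_symm.mono fun x hx => (hδW hx).2.1)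
      fun x hx => (hδW hx).2.2
  obtain ⟨u, hu, hφu⟩ := exists_eq_coord_smul hq hφd fun x hx hx0 =>
    (hφ.mem_iff _ (hδW hx).2.2).1 ((he.symm_mem_iff (hδW hx).2.1).2 hx0)
  -- At q the product rule gives d(x₀u) = u(q) dx₀, so u(q) = 0 would force dφ = 0 there.
  have huq : u q ≠ 0 := by
    intro hu0
    refine hφ.fderiv_ne_zero (e.symm q) ⟨hpU, (he.symm_mem_iff hqt).2 hq⟩ ?_
    have hud := hu.differentiableAt (isOpen_ball.mem_nhds (mem_ball_self hδ))
    have hcoord : HasFDerivAt (fun x : Fin (n + 1) → ℂ => x 0)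
        (ContinuousLinearMap.proj (R := ℂ) (φ := fun _ : Fin (n + 1) => ℂ) 0) q :=
      (ContinuousLinearMap.proj (R := ℂ) (φ := fun _ : Fin (n + 1) => ℂ) 0).hasFDerivAt
    have h1 : HasFDerivAt (fun x => φ (e.symm x)) (0 : (Fin (n + 1) → ℂ) →L[ℂ] ℂ)
        (e (e.symm q)) := by
      rw [e.right_inv hqt]
      have h2 := hcoord.smul hud.hasFDerivAt
      rw [hq, hu0] at h2
      refine HasFDerivAt.congr_of_eventuallyEq (h2.congr_fderiv ?_)
        (EqOn.eventuallyEq_of_mem (s := ball q δ) hφu (ball_mem_nhds _ hδ))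
      ext v
      simp
    have h3 := h1.comp (e.symm q) (he.differentiableOn.differentiableAt
      (e.open_source.mem_nhds (e.map_target hqt))).hasFDerivAt
    rw [ContinuousLinearMap.zero_comp] at h3
    refine (h3.congr_of_eventuallyEq ?_).fderiv
    filter_upwards [e.open_source.mem_nhds (e.map_target hqt)] with z hz
    simp [e.left_inv hz]
  have hO : IsOpen (ball q δ ∩ u ⁻¹' {0}ᶜ) :=
    hu.continuousOn.isOpen_inter_preimage isOpen_ball isOpen_compl_singleton
  have hmap : ∀ z ∈ e.source ∩ e ⁻¹' (ball q δ ∩ u ⁻¹' {0}ᶜ), z ∈ U := fun z hz => by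
    have := (hδW hz.2.1).2.2
    rwa [mem_preimage, e.left_inv hz.1] at this
  have hed : DifferentiableOn ℂ e (e.source ∩ e ⁻¹' (ball q δ ∩ u ⁻¹' {0}ᶜ)) :=
    he.differentiableOn.mono inter_subset_left
  refine ⟨e.source ∩ e ⁻¹' (ball q δ ∩ u ⁻¹' {0}ᶜ), hmap,
    ⟨e.map_target hqt, by
      rw [mem_preimage, e.right_inv hqt]; exact ⟨mem_ball_self hδ, huq⟩⟩,
    e.isOpen_inter_preimage hO, fun z => g (e z) / u (e z) ^ k, ?_, fun z hz => ?_⟩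
  · have h1 : DifferentiableOn ℂ (fun z => g (e z)) _ := hg.comp hed fun z hz => (hδW hz.2.1).1
    have h2 : DifferentiableOn ℂ (fun z => u (e z)) _ := hu.comp hed fun z hz => hz.2.1
    simp only [div_eq_mul_inv]
    exact h1.fun_mul ((h2.fun_pow k).fun_inv fun z hz => pow_ne_zero k hz.2.2)
  · have h1 := hfg (e z) (hδW hz.2.1).1
    have h2 := hφu (e z) hz.2.1
    simp only [e.left_inv hz.1, smul_eq_mul] at h1 h2
    have h3 : u (e z) ≠ 0 := hz.2.2
    rw [h1, h2, mul_pow]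
    field_simp

/-- On a connected hypersurface, vanishing near one point implies vanishing everywhere. -/
theorem VanishesAt.vanishesToOrder {charts : Set (OpenPartialHomeomorph (Fin (n + 1) → ℂ)
    (Fin (n + 1) → ℂ))} (hcharts : ∀ e ∈ charts, IsAdaptedChart Ω Z e)
    (hcover : ∀ p ∈ Z, ∃ e ∈ charts, p ∈ e.source) (hZ : IsPreconnected Z)
    {f : (Fin (n + 1) → ℂ) → ℂ} (hf : DifferentiableOn ℂ f Ω) {p : Fin (n + 1) → ℂ} (hp : p ∈ Z)
    (h : VanishesAt Z k f p) : VanishesToOrder Z k f := by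
  -- Within one polydisc of a chart, the normal derivatives of order below k vanish on the whole
  -- slice as soon as they vanish near one of its points. So the truth value cannot change locally
  -- on Z.
  have hloc : IsLocallyConstant fun p : Z => VanishesAt Z k f p := by
    rw [IsLocallyConstant.iff_eventually_eq]
    rintro ⟨p, hp⟩
    obtain ⟨e, hec, hpe⟩ := hcover p hp
    have he := hcharts e hec
    obtain ⟨r, hr, hball⟩ := Metric.isOpen_iff.1 e.open_target (e p) (e.map_source hpe)
    have hfd : DifferentiableOn ℂ (fun x => f (e.symm x)) (ball (e p) r) :=
      hf.comp (he.differentiableOn_symm.mono hball) fun x hx => he.symm_mem (hball hx)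
    have key : ∀ p₁ ∈ e.source ∩ e ⁻¹' ball (e p) r, ∀ p₂ ∈ e.source ∩ e ⁻¹' ball (e p) r,
        p₁ ∈ Z → p₂ ∈ Z → VanishesAt Z k f p₁ → VanishesAt Z k f p₂ := by
      intro p₁ hp₁ p₂ hp₂ hz₁ hz₂ hv
      have hv' : VanishesAt Z k f (e.symm (e p₁)) := by rwa [e.left_inv hp₁.1]
      have hev := hv'.eventually_iterate_dirDeriv_eq_zero he (hball hp₁.2)
      obtain ⟨δ, hδ, hδb⟩ := Metric.isOpen_iff.1 isOpen_ball (e p₂) hp₂.2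
      have := vanishesAt_of_iterate_dirDeriv_eq_zero he (k := k) hδ
        ((he.mem_iff _ hp₂.1).1 hz₂) (hδb.trans hball) (hfd.mono hδb) fun a ha x hx hx0 =>
          eq_zero_on_slice (differentiableOn_iterate_dirDeriv isOpen_ball hfd a) hp₁.2 (hδb hx)
            ((he.mem_iff _ hp₁.1).1 hz₁) hx0 (hev.mono fun x hx hx0 => hx hx0 a ha)
      rwa [e.left_inv hp₂.1] at this
    have hN : IsOpen (e.source ∩ e ⁻¹' ball (e p) r) := e.isOpen_inter_preimage isOpen_ball
    have hpN : p ∈ e.source ∩ e ⁻¹' ball (e p) r := ⟨hpe, mem_ball_self hr⟩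
    filter_upwards [(hN.preimage continuous_subtype_val).mem_nhds
      (show (⟨p, hp⟩ : Z) ∈ Subtype.val ⁻¹' _ from hpN)] with p' hp'
    exact propext ⟨key _ hp' _ hpN p'.2 hp, key _ hpN _ hp' hp p'.2⟩
  have : PreconnectedSpace Z := isPreconnected_iff_preconnectedSpace.1 hZ
  intro p' hp'
  have := hloc.apply_eq_of_preconnectedSpace ⟨p, hp⟩ ⟨p', hp'⟩
  exact (Eq.mp this h : VanishesAt Z k f p')

end Vanishing

/-! ### Jets of local frames and the elements vanishing to order k. -/

section LocalFrame

theorem iterate_dirDeriv_conj {m : ℕ} {F : (Fin m → ℂ) → ℂ} {q v : Fin m → ℂ} {r : ℝ}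
    (hF : DifferentiableOn ℂ F (ball q r)) (a : ℕ) :
    EqOn ((dirDeriv v)^[a] fun y => star (F (star y)))
      (fun y => star ((dirDeriv (star v))^[a] F (star y))) (ball (star q) r) := by
  have hF' : DifferentiableOn ℂ F (ball (star (star q)) r) := by rwa [star_star]
  -- The doubly conjugated function is the dual family of `G`, with ℂ as Hilbert space, evaluated at
  -- 1; the calculus of `conjDual` then applies.
  have e : ∀ G : (Fin m → ℂ) → ℂ, (fun y => star (G (star y))) =
      fun y => ContinuousLinearMap.apply ℂ ℂ (1 : ℂ) (conjDual G y) := fun G => by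
    funext y
    simp [conjDual_apply]
  intro y hy
  rw [e F, e ((dirDeriv (star v))^[a] F),
    iterate_dirDeriv_clm isOpen_ball (differentiableOn_conjDual hF') _ a hy]
  simp only
  rw [iterate_dirDeriv_conjDual hF' a hy]

theorem differentiableOn_conj {m : ℕ} {F : (Fin m → ℂ) → ℂ} {q : Fin m → ℂ} {r : ℝ}
    (hF : DifferentiableOn ℂ F (ball q r)) :
    DifferentiableOn ℂ (fun y => star (F (star y))) (ball (star q) r) := fun y hy => by
  have := (hF.differentiableAt (isOpen_ball.mem_nhds (mem_ball_star.1 hy))).star_star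
  rw [star_star] at this
  exact this.differentiableWithinAt

theorem differentiableOn_inner {m : ℕ} {H : Type*} [NormedAddCommGroup H] [InnerProductSpace ℂ H]
    {S : (Fin m → ℂ) → H} {U : Set (Fin m → ℂ)} (hS : DifferentiableOn ℂ S U) (h : H) :
    DifferentiableOn ℂ (fun y => ⟪h, S y⟫_ℂ) U :=
  (innerSL ℂ h).differentiable.comp_differentiableOn hS

theorem inner_iterate_dirDeriv {m : ℕ} {H : Type*} [NormedAddCommGroup H]
    [InnerProductSpace ℂ H] [CompleteSpace H] {S : (Fin m → ℂ) → H} {U : Set (Fin m → ℂ)}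
    (hU : IsOpen U) (hS : DifferentiableOn ℂ S U) (h : H) (v : Fin m → ℂ) (a : ℕ)
    {y : Fin m → ℂ} (hy : y ∈ U) :
    ⟪h, (dirDeriv v)^[a] S y⟫_ℂ = (dirDeriv v)^[a] (fun y => ⟪h, S y⟫_ℂ) y :=
  (iterate_dirDeriv_clm hU hS (innerSL ℂ h) a hy).symm

variable {n k : ℕ} {Ω Z : Set (Fin (n + 1) → ℂ)}
  {e : OpenPartialHomeomorph (Fin (n + 1) → ℂ) (Fin (n + 1) → ℂ)}
  {H : Type*} [NormedAddCommGroup H] [InnerProductSpace ℂ H] [CompleteSpace H]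
  {M : QuasiFreeModule Ω H} {q : Fin (n + 1) → ℂ} {r : ℝ} {S : (Fin (n + 1) → ℂ) → H}

/-- A holomorphic frame of the line bundle of a module, written in the coordinates conjugate to a
chart, over a polydisc. -/
structure IsLocalFrame (M : QuasiFreeModule Ω H)
    (e : OpenPartialHomeomorph (Fin (n + 1) → ℂ) (Fin (n + 1) → ℂ)) (q : Fin (n + 1) → ℂ) (r : ℝ)
    (S : (Fin (n + 1) → ℂ) → H) : Prop where
  differentiableOn : DifferentiableOn ℂ S (ball (star q) r)
  mem_fibre : ∀ y ∈ ball (star q) r, ∃ w : Ω, (w : Fin (n + 1) → ℂ) = e.symm (star y) ∧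
    S y ∈ Submodule.span ℂ {M.kernelVec w}
  ne_zero : ∀ y ∈ ball (star q) r, S y ≠ 0

theorem QuasiFreeModule.IsFrame.isLocalFrame {s : (Fin (n + 1) → ℂ) → H} (hs : M.IsFrame s)
    (hΩ : IsOpen Ω) (he : IsAdaptedChart Ω Z e) (hball : ball q r ⊆ e.target) :
    IsLocalFrame M e q r fun y => s (star (e.symm (star y))) where
  differentiableOn := by
    have hopen : IsOpen {v : Fin (n + 1) → ℂ | star v ∈ Ω} := hΩ.preimage continuous_star
    intro y hy
    have hy' := hball (mem_ball_star.1 hy)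
    have h1 := (he.differentiableOn_symm.differentiableAt
      (e.open_target.mem_nhds hy')).star_star
    rw [star_star] at h1
    have h2 : DifferentiableAt ℂ s ((star ∘ e.symm ∘ star) y) :=
      hs.differentiableOn.differentiableAt (hopen.mem_nhds (by
        simpa using he.symm_mem hy'))
    exact (h2.comp y h1).differentiableWithinAt
  mem_fibre y hy := ⟨⟨_, he.symm_mem (hball (mem_ball_star.1 hy))⟩, rfl, hs.mem_fibre _⟩
  ne_zero y hy := hs.ne_zero ⟨_, he.symm_mem (hball (mem_ball_star.1 hy))⟩

namespace IsLocalFrame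

theorem mono (hS : IsLocalFrame M e q r S) {q' : Fin (n + 1) → ℂ} {r' : ℝ}
    (h : ball q' r' ⊆ ball q r) : IsLocalFrame M e q' r' S := by
  have h' : ball (star q') r' ⊆ ball (star q) r := fun y hy =>
    mem_ball_star.2 (h (mem_ball_star.1 hy))
  exact ⟨hS.differentiableOn.mono h', fun y hy => hS.mem_fibre y (h' hy),
    fun y hy => hS.ne_zero y (h' hy)⟩

theorem smul (hS : IsLocalFrame M e q r S) {χ : (Fin (n + 1) → ℂ) → ℂ}
    (hχ : DifferentiableOn ℂ χ (ball (star q) r)) (h0 : ∀ y ∈ ball (star q) r, χ y ≠ 0) :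
    IsLocalFrame M e q r fun y => χ y • S y where
  differentiableOn := hχ.smul hS.differentiableOn
  mem_fibre y hy := by
    obtain ⟨w, hw, h⟩ := hS.mem_fibre y hy
    exact ⟨w, hw, Submodule.smul_mem _ _ h⟩
  ne_zero y hy := smul_ne_zero (h0 y hy) (hS.ne_zero y hy)

theorem inner_one_ne_zero (hS : IsLocalFrame M e q r S) {y : Fin (n + 1) → ℂ}
    (hy : y ∈ ball (star q) r) : ⟪M.one, S y⟫_ℂ ≠ 0 := by
  obtain ⟨w, -, h⟩ := hS.mem_fibre y hy
  exact QuasiFreeModule.inner_one_ne_zero h (hS.ne_zero y hy)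

theorem inner_eq (hS : IsLocalFrame M e q r S) {y : Fin (n + 1) → ℂ} (hy : y ∈ ball (star q) r)
    (h : H) : ⟪h, S y⟫_ℂ = ⟪M.one, S y⟫_ℂ • star (M.toFun h (e.symm (star y))) := by
  obtain ⟨w, hw, hv⟩ := hS.mem_fibre y hy
  rw [← hw, QuasiFreeModule.toFun_of_mem _ _ w.2]
  exact QuasiFreeModule.inner_eq_of_mem_fibre hv h

theorem inner_act (hS : IsLocalFrame M e q r S) {y : Fin (n + 1) → ℂ} (hy : y ∈ ball (star q) r)
    (f : funAlg Ω) (h : H) :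
    ⟪M.act f h, S y⟫_ℂ = star (M.toFun (M.incl f) (e.symm (star y))) • ⟪h, S y⟫_ℂ := by
  obtain ⟨w, hw, hv⟩ := hS.mem_fibre y hy
  rw [← hw, QuasiFreeModule.toFun_of_mem _ _ w.2, QuasiFreeModule.eval_incl]
  exact QuasiFreeModule.inner_act_of_mem_fibre hv f h

theorem differentiableOn_toFun_symm (hM : ∀ h, DifferentiableOn ℂ (M.toFun h) Ω)
    (he : IsAdaptedChart Ω Z e) (hball : ball q r ⊆ e.target) (h : H) :
    DifferentiableOn ℂ (fun x => M.toFun h (e.symm x)) (ball q r) :=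
  (hM h).comp (he.differentiableOn_symm.mono hball) fun _ hx => he.symm_mem (hball hx)

theorem inner_act_iterate (hS : IsLocalFrame M e q r S)
    (hM : ∀ h, DifferentiableOn ℂ (M.toFun h) Ω) (he : IsAdaptedChart Ω Z e)
    (hball : ball q r ⊆ e.target) (f : funAlg Ω) (h : H) (a : ℕ) {y : Fin (n + 1) → ℂ}
    (hy : y ∈ ball (star q) r) :
    ⟪M.act f h, (dirDeriv e₀)^[a] S y⟫_ℂ =
      ⟪h, (dirDeriv e₀)^[a] (fun y => star (M.toFun (M.incl f) (e.symm (star y))) • S y) y⟫_ℂ := by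
  have hf := differentiableOn_conj (differentiableOn_toFun_symm hM he hball (M.incl f))
  rw [inner_iterate_dirDeriv isOpen_ball hS.differentiableOn _ _ _ hy,
    inner_iterate_dirDeriv isOpen_ball (hf.fun_smul hS.differentiableOn) _ _ _ hy]
  refine iterate_dirDeriv_congr isOpen_ball (fun y hy => ?_) a hy
  rw [hS.inner_act hy, inner_smul_right, smul_eq_mul]

theorem star_e₀ : star (e₀ : Fin (n + 1) → ℂ) = e₀ := star_single_one 0

/-- The pairing is a holomorphic factor times the conjugate of h, whose normal derivatives of order
below k vanish on the slice. So the jets of the frame lie in the quotient. -/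
theorem inner_iterate_eq_zero_of_mem_vanishing (hS : IsLocalFrame M e q r S)
    (hM : ∀ h, DifferentiableOn ℂ (M.toFun h) Ω) (he : IsAdaptedChart Ω Z e)
    (hball : ball q r ⊆ e.target) {h : H} (hh : h ∈ M.vanishing Z k) {a : ℕ} (ha : a < k)
    {y : Fin (n + 1) → ℂ} (hy : y ∈ ball (star q) r) (hy0 : y 0 = 0) :
    ⟪h, (dirDeriv e₀)^[a] S y⟫_ℂ = 0 := by
  have hF := differentiableOn_toFun_symm hM he hball h
  have hyt := hball (mem_ball_star.1 hy)
  have hy0' : star y 0 = 0 := by simp [hy0]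
  rw [inner_iterate_dirDeriv isOpen_ball hS.differentiableOn _ _ _ hy,
    iterate_dirDeriv_congr isOpen_ball (fun y hy => hS.inner_eq hy h) a hy]
  refine iterate_dirDeriv_smul_eq_zero isOpen_ball
    (differentiableOn_inner hS.differentiableOn _) (differentiableOn_conj hF) hy fun b hb => ?_
  have hv : VanishesAt Z k (M.toFun h) (e.symm (star y)) :=
    hh _ ((he.symm_mem_iff hyt).2 hy0')
  rw [iterate_dirDeriv_conj hF b hy]
  simp only [star_e₀]
  rw [(hv.eventually_iterate_dirDeriv_eq_zero he hyt).self_of_nhds hy0' b (by omega), star_zero]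

/-- Dividing the pairing by the zero-free ⟪1, S⟫ recovers the conjugate of h, so h vanishes to order
k at the centre, and then on all of Z by connectedness. This makes the jets over a single polydisc
total in the quotient. -/
theorem mem_vanishing_of_inner_iterate_eq_zero (hS : IsLocalFrame M e q r S)
    (hM : ∀ h, DifferentiableOn ℂ (M.toFun h) Ω) (he : IsAdaptedChart Ω Z e)
    (hball : ball q r ⊆ e.target) (hr : 0 < r) (hq : q 0 = 0)
    {charts : Set (OpenPartialHomeomorph (Fin (n + 1) → ℂ) (Fin (n + 1) → ℂ))}
    (hcharts : ∀ e ∈ charts, IsAdaptedChart Ω Z e)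
    (hcover : ∀ p ∈ Z, ∃ e ∈ charts, p ∈ e.source) (hZ : IsPreconnected Z) {h : H}
    (hh : ∀ a < k, ∀ y ∈ ball (star q) r, y 0 = 0 → ⟪h, (dirDeriv e₀)^[a] S y⟫_ℂ = 0) :
    h ∈ M.vanishing Z k := by
  have hF := differentiableOn_toFun_symm hM he hball h
  have hqt : q ∈ e.target := hball (mem_ball_self hr)
  refine VanishesAt.vanishesToOrder hcharts hcover hZ (hM h) ((he.symm_mem_iff hqt).2 hq)
    (vanishesAt_of_iterate_dirDeriv_eq_zero he hr hq hball hF fun a ha x hx hx0 => ?_)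
  have hy : star x ∈ ball (star q) r := star_mem_ball_star.2 hx
  have h1 := iterate_dirDeriv_conj (v := e₀) hF a hy
  simp only [star_e₀, star_star] at h1
  rw [← star_eq_zero, ← h1]
  have hone := differentiableOn_inner hS.differentiableOn M.one
  have heq : EqOn (fun y => star (M.toFun h (e.symm (star y))))
      (fun y => (⟪M.one, S y⟫_ℂ)⁻¹ • ⟪h, S y⟫_ℂ) (ball (star q) r) := fun y hy => by
    simp only
    rw [hS.inner_eq hy h, smul_smul, inv_mul_cancel₀ (hS.inner_one_ne_zero hy), one_smul]
  rw [iterate_dirDeriv_congr isOpen_ball heq a hy]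
  refine iterate_dirDeriv_smul_eq_zero isOpen_ball
    (hone.fun_inv fun y hy => hS.inner_one_ne_zero hy)
    (differentiableOn_inner hS.differentiableOn h) hy fun b hb => ?_
  rw [← inner_iterate_dirDeriv isOpen_ball hS.differentiableOn _ _ _ hy]
  exact hh b (by omega) _ hy (by simp [hx0])

theorem iterate_mem_quotient (hS : IsLocalFrame M e q r S)
    (hM : ∀ h, DifferentiableOn ℂ (M.toFun h) Ω) (he : IsAdaptedChart Ω Z e)
    (hball : ball q r ⊆ e.target) {a : ℕ} (ha : a < k)
    {y : Fin (n + 1) → ℂ} (hy : y ∈ ball (star q) r) (hy0 : y 0 = 0) :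
    (dirDeriv e₀)^[a] S y ∈ M.quotient Z k :=
  (Submodule.mem_orthogonal _ _).2 fun _ hh =>
    hS.inner_iterate_eq_zero_of_mem_vanishing hM he hball hh ha hy hy0

end IsLocalFrame

end LocalFrame

/-! ### Unitary equivalence from equal Gram matrices. -/

section Gram

variable {ι K K' : Type*} [NormedAddCommGroup K] [InnerProductSpace ℂ K]
  [NormedAddCommGroup K'] [InnerProductSpace ℂ K']

theorem inner_linearCombination (v : ι → K) (c d : ι →₀ ℂ) :
    ⟪Finsupp.linearCombination ℂ v c, Finsupp.linearCombination ℂ v d⟫_ℂ =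
      d.sum fun j b => c.sum fun i a => b * ((starRingEnd ℂ) a * ⟪v i, v j⟫_ℂ) := by
  simp only [Finsupp.linearCombination_apply, Finsupp.sum_inner, Finsupp.inner_sum,
    inner_smul_left, inner_smul_right, Finsupp.mul_sum]

theorem denseRange_linearCombination [CompleteSpace K] {v : ι → K}
    (hv : ∀ x : K, (∀ i, ⟪x, v i⟫_ℂ = 0) → x = 0) :
    DenseRange (Finsupp.linearCombination ℂ v) := by
  have h : (Submodule.span ℂ (range v)).topologicalClosure = ⊤ := by
    rw [Submodule.topologicalClosure_eq_top_iff, Submodule.eq_bot_iff]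
    intro x hx
    refine hv x fun i => ?_
    exact (Submodule.mem_orthogonal' _ _).1 hx _ (Submodule.subset_span ⟨i, rfl⟩)
  rw [← Finsupp.range_linearCombination] at h
  exact Submodule.dense_iff_topologicalClosure_eq_top.2 h

/-- Total families with equal Gram matrices are unitarily equivalent. -/
theorem exists_linearIsometryEquiv_of_gram [CompleteSpace K] [CompleteSpace K']
    {v : ι → K} {v' : ι → K'}
    (hv : ∀ x : K, (∀ i, ⟪x, v i⟫_ℂ = 0) → x = 0)
    (hv' : ∀ x : K', (∀ i, ⟪x, v' i⟫_ℂ = 0) → x = 0)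
    (hgram : ∀ i j, ⟪v i, v j⟫_ℂ = ⟪v' i, v' j⟫_ℂ) :
    ∃ V : K ≃ₗᵢ[ℂ] K', ∀ i, V (v i) = v' i := by
  have hnorm : ∀ c, ‖Finsupp.linearCombination ℂ v c‖ = ‖Finsupp.linearCombination ℂ v' c‖ :=
    fun c => by
      rw [norm_eq_sqrt_re_inner (𝕜 := ℂ), norm_eq_sqrt_re_inner (𝕜 := ℂ),
        inner_linearCombination, inner_linearCombination]
      simp only [hgram]
  have hd := denseRange_linearCombination hv
  have hd' := denseRange_linearCombination hv'
  set L := Finsupp.linearCombination ℂ v with hL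
  set L' := Finsupp.linearCombination ℂ v' with hL'
  have hb : ∀ c, ‖L' c‖ ≤ 1 * ‖L c‖ := fun c => by rw [one_mul, hnorm]
  have hb' : ∀ c, ‖L c‖ ≤ 1 * ‖L' c‖ := fun c => by rw [one_mul, hnorm]
  set T := L'.extendOfNorm L with hT
  set T' := L.extendOfNorm L' with hT'
  have h1 : ∀ c, T (L c) = L' c := fun c => LinearMap.extendOfNorm_eq hd ⟨1, hb⟩ c
  have h2 : ∀ c, T' (L' c) = L c := fun c => LinearMap.extendOfNorm_eq hd' ⟨1, hb'⟩ c
  have e1 : ∀ x, T' (T x) = x := congrFun (hd.equalizer (g := fun x => T' (T x)) (h := id)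
    (by fun_prop) continuous_id (by funext c; simp [h1, h2]))
  have e2 : ∀ x, T (T' x) = x := congrFun (hd'.equalizer (g := fun x => T (T' x)) (h := id)
    (by fun_prop) continuous_id (by funext c; simp [h1, h2]))
  have n1 : ∀ x, ‖T x‖ ≤ ‖x‖ := fun x => by
    simpa using LinearMap.norm_extendOfNorm_apply_le hd 1 hb x
  have n2 : ∀ x, ‖T' x‖ ≤ ‖x‖ := fun x => by
    simpa using LinearMap.norm_extendOfNorm_apply_le hd' 1 hb' x
  refine ⟨⟨LinearEquiv.ofLinearMap T.toLinearMap T'.toLinearMap (LinearMap.ext e2)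
    (LinearMap.ext e1), fun x => le_antisymm (n1 x) ?_⟩, fun i => ?_⟩
  · have := n2 (T x)
    rwa [e1] at this
  · have := h1 (Finsupp.single i 1)
    rw [hL, hL', Finsupp.linearCombination_single, Finsupp.linearCombination_single, one_smul,
      one_smul] at this
    exact this

end Gram

/-! ### Isomorphism of quotients in terms of Gram matrices of jets. -/

section Quotient

variable {n k : ℕ} {Ω Z : Set (Fin (n + 1) → ℂ)}
  {e : OpenPartialHomeomorph (Fin (n + 1) → ℂ) (Fin (n + 1) → ℂ)}
  {H H' : Type*} [NormedAddCommGroup H] [InnerProductSpace ℂ H] [CompleteSpace H]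
  [NormedAddCommGroup H'] [InnerProductSpace ℂ H'] [CompleteSpace H']
  {M : QuasiFreeModule Ω H} {M' : QuasiFreeModule Ω H'} {q : Fin (n + 1) → ℂ} {r : ℝ}
  {S : (Fin (n + 1) → ℂ) → H} {S' : (Fin (n + 1) → ℂ) → H'}

theorem toFun_incl_eq (M : QuasiFreeModule Ω H) (M' : QuasiFreeModule Ω H') (f : funAlg Ω) :
    M.toFun (M.incl f) = M'.toFun (M'.incl f) := by
  funext w
  by_cases hw : w ∈ Ω
  · rw [QuasiFreeModule.toFun_of_mem _ _ hw, QuasiFreeModule.toFun_of_mem _ _ hw,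
      QuasiFreeModule.eval_incl, QuasiFreeModule.eval_incl]
  · simp [QuasiFreeModule.toFun, hw]

/-- The quotient action does not depend on the representative, since the action preserves the kernel
of the projection. -/
theorem QuasiFreeModule.IsFrame.quotientAct_projection {s : (Fin (n + 1) → ℂ) → H}
    (hs : M.IsFrame s) (hΩ : IsOpen Ω) (hZ : Z ⊆ Ω) (f : funAlg Ω) (u : H) :
    M.quotientAct Z k f ((M.quotient Z k).orthogonalProjectionOnto u) =
      (M.quotient Z k).orthogonalProjectionOnto (M.act f u) := by
  rw [quotientAct, ← sub_eq_zero, ← map_sub, ← map_sub,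
    Submodule.orthogonalProjectionOnto_eq_zero_iff]
  refine hs.act_mem_orthogonal_quotient hΩ hZ f ?_
  rw [← neg_sub]
  refine Submodule.neg_mem _ ?_
  exact Submodule.sub_starProjection_mem_orthogonal u

/-- If the quotients are isomorphic, then the jets of a frame of the first module have the same
Gram matrix as the jets of a multiple of a frame of the second. -/
theorem exists_smul_gram_eq (hiso : QuotientsIsomorphic M M' Z k)
    {s : (Fin (n + 1) → ℂ) → H} (hs : M.IsFrame s) {s' : (Fin (n + 1) → ℂ) → H'}
    (hs' : M'.IsFrame s') (hΩ : IsOpen Ω) (hZ : Z ⊆ Ω) (he : IsAdaptedChart Ω Z e)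
    (hball : ball q r ⊆ e.target) (hS : IsLocalFrame M e q r S)
    (hS' : IsLocalFrame M' e q r S') :
    ∃ χ : (Fin (n + 1) → ℂ) → ℂ, DifferentiableOn ℂ χ (ball (star q) r) ∧
      ∀ a < k, ∀ b < k, ∀ y ∈ ball (star q) r, ∀ y' ∈ ball (star q) r, y 0 = 0 → y' 0 = 0 →
        ⟪(dirDeriv e₀)^[a] S y, (dirDeriv e₀)^[b] S y'⟫_ℂ =
          ⟪(dirDeriv e₀)^[a] (fun y => χ y • S' y) y,
            (dirDeriv e₀)^[b] (fun y => χ y • S' y) y'⟫_ℂ := by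
  obtain ⟨V, hV⟩ := hiso
  have hM := fun h => hs.differentiableOn_toFun hΩ h
  set g₀ : M.quotient Z k := V.symm ((M'.quotient Z k).orthogonalProjectionOnto M'.one) with hg₀
  -- The only possible choice: if V sends S(y) to χ(y)S'(y), pairing with the class of 1 gives ⟪g₀,
  -- S(y)⟫ = χ(y)⟪1, S'(y)⟫.
  set χ : (Fin (n + 1) → ℂ) → ℂ := fun y => (⟪M'.one, S' y⟫_ℂ)⁻¹ * ⟪(g₀ : H), S y⟫_ℂ with hχ
  have hχd : DifferentiableOn ℂ χ (ball (star q) r) :=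
    ((differentiableOn_inner hS'.differentiableOn _).fun_inv
      fun y hy => hS'.inner_one_ne_zero hy).fun_mul (differentiableOn_inner hS.differentiableOn _)
  have key : ∀ b (hb : b < k), ∀ y (hy : y ∈ ball (star q) r) (hy0 : y 0 = 0),
      (V ⟨_, hS.iterate_mem_quotient hM he hball hb hy hy0⟩ : H') =
        (dirDeriv e₀)^[b] (fun y => χ y • S' y) y := by
    intro b hb y hy hy0
    set J : M.quotient Z k := ⟨_, hS.iterate_mem_quotient hM he hball hb hy hy0⟩ with hJ
    have hχS : DifferentiableOn ℂ (fun y => χ y • S' y) (ball (star q) r) :=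
      hχd.fun_smul hS'.differentiableOn
    -- Since V is a module map, the class of f = f · 1 comes from that of f · g₀. Before
    -- differentiation both sides are then the conjugate of f times ⟪g₀, S(y)⟫.
    have htest : ∀ f : funAlg Ω, ⟪M'.incl f, (V J : H')⟫_ℂ =
        ⟪M'.incl f, (dirDeriv e₀)^[b] (fun y => χ y • S' y) y⟫_ℂ := by
      intro f
      have h1 : V.symm ((M'.quotient Z k).orthogonalProjectionOnto (M'.incl f)) =
          (M.quotient Z k).orthogonalProjectionOnto (M.act f g₀) := by
        rw [← M'.act_one, ← hs'.quotientAct_projection hΩ hZ, V.symm_apply_eq]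
        refine Eq.trans ?_ (hV f g₀).symm
        rw [hg₀, V.apply_symm_apply]
      have h2 : ⟪M'.incl f, (V J : H')⟫_ℂ = ⟪M.act f g₀, (J : H)⟫_ℂ := by
        rw [← Submodule.inner_orthogonalProjectionOnto_eq_of_mem_right,
          ← Submodule.inner_orthogonalProjectionOnto_eq_of_mem_right, ← h1,
          ← V.inner_map_map, V.apply_symm_apply]
      rw [h2, inner_iterate_dirDeriv isOpen_ball hχS _ _ _ hy]
      simp only [hJ]
      rw [inner_iterate_dirDeriv isOpen_ball hS.differentiableOn _ _ _ hy]
      refine iterate_dirDeriv_congr isOpen_ball (fun y hy => ?_) b hy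
      rw [hS.inner_act hy, inner_smul_right, ← M'.act_one, hS'.inner_act hy,
        toFun_incl_eq M M', hχ]
      have := hS'.inner_one_ne_zero hy
      simp only [smul_eq_mul]
      field_simp
    refine ext_inner_left ℂ fun x => ?_
    exact congrFun (M'.denseRange_incl.equalizer (g := fun x => ⟪x, (V J : H')⟫_ℂ)
      (h := fun x => ⟪x, (dirDeriv e₀)^[b] (fun y => χ y • S' y) y⟫_ℂ) (by fun_prop)
      (by fun_prop) (funext htest)) x
  refine ⟨χ, hχd, fun a ha b hb y hy y' hy' hy0 hy0' => ?_⟩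
  rw [← key a ha y hy hy0, ← key b hb y' hy' hy0', ← Submodule.coe_inner, V.inner_map_map]
  rfl

/-- Modules whose frames have jets with equal Gram matrices have isomorphic quotients. -/
theorem quotientsIsomorphic_of_gram
    {s : (Fin (n + 1) → ℂ) → H} (hs : M.IsFrame s) {s' : (Fin (n + 1) → ℂ) → H'}
    (hs' : M'.IsFrame s') (hΩ : IsOpen Ω) (he : IsAdaptedChart Ω Z e)
    {charts : Set (OpenPartialHomeomorph (Fin (n + 1) → ℂ) (Fin (n + 1) → ℂ))}
    (hcharts : ∀ e ∈ charts, IsAdaptedChart Ω Z e)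
    (hcover : ∀ p ∈ Z, ∃ e ∈ charts, p ∈ e.source) (hZ : IsPreconnected Z)
    (hball : ball q r ⊆ e.target) (hr : 0 < r) (hq : q 0 = 0) (hS : IsLocalFrame M e q r S)
    (hS' : IsLocalFrame M' e q r S')
    (hgram : ∀ a < k, ∀ b < k, ∀ y ∈ ball (star q) r, ∀ y' ∈ ball (star q) r, y 0 = 0 → y' 0 = 0 →
      ⟪(dirDeriv e₀)^[a] S y, (dirDeriv e₀)^[b] S y'⟫_ℂ =
        ⟪(dirDeriv e₀)^[a] S' y, (dirDeriv e₀)^[b] S' y'⟫_ℂ) :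
    QuotientsIsomorphic M M' Z k := by
  have hM := fun h => hs.differentiableOn_toFun hΩ h
  have hM' := fun h => hs'.differentiableOn_toFun hΩ h
  let ι := {p : ℕ × (Fin (n + 1) → ℂ) // p.1 < k ∧ p.2 ∈ ball (star q) r ∧ p.2 0 = 0}
  let v : ι → M.quotient Z k := fun p =>
    ⟨_, hS.iterate_mem_quotient hM he hball p.2.1 p.2.2.1 p.2.2.2⟩
  let v' : ι → M'.quotient Z k := fun p =>
    ⟨_, hS'.iterate_mem_quotient hM' he hball p.2.1 p.2.2.1 p.2.2.2⟩
  have hv : ∀ x : M.quotient Z k, (∀ i, ⟪x, v i⟫_ℂ = 0) → x = 0 := fun x hx => by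
    have h1 : (x : H) ∈ M.vanishing Z k :=
      hS.mem_vanishing_of_inner_iterate_eq_zero hM he hball hr hq hcharts hcover hZ
        fun a ha y hy hy0 => hx ⟨(a, y), ha, hy, hy0⟩
    have h2 := (Submodule.mem_orthogonal _ _).1 x.2 _ h1
    exact Subtype.ext (inner_self_eq_zero.1 h2)
  have hv' : ∀ x : M'.quotient Z k, (∀ i, ⟪x, v' i⟫_ℂ = 0) → x = 0 := fun x hx => by
    have h1 : (x : H') ∈ M'.vanishing Z k :=
      hS'.mem_vanishing_of_inner_iterate_eq_zero hM' he hball hr hq hcharts hcover hZ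
        fun a ha y hy hy0 => hx ⟨(a, y), ha, hy, hy0⟩
    have h2 := (Submodule.mem_orthogonal _ _).1 x.2 _ h1
    exact Subtype.ext (inner_self_eq_zero.1 h2)
  obtain ⟨V, hV⟩ := exists_linearIsometryEquiv_of_gram hv hv' fun i j =>
    hgram _ i.2.1 _ j.2.1 _ i.2.2.1 _ j.2.2.1 i.2.2.2 j.2.2.2
  refine ⟨V, fun f h => ?_⟩
  rw [← sub_eq_zero]
  -- Intertwining is tested against the jets of `S'`, where adjoints of the action multiply by the
  -- conjugate of f inside the derivative.
  refine hv' _ fun i => ?_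
  obtain ⟨⟨a, y⟩, ha, hy, hy0⟩ := i
  have hφ := differentiableOn_conj
    (IsLocalFrame.differentiableOn_toFun_symm hM he hball (M.incl f))
  -- Projecting first extends V to all of H. It matches the jets of S and S' up to order a, hence
  -- also the a-th derivatives after multiplication by the same scalar function.
  have hclm := clm_iterate_dirDeriv_smul (v := e₀) (a := a) isOpen_ball hφ hS.differentiableOn
    hS'.differentiableOn ((M'.quotient Z k).subtypeL.comp
      ((V.toContinuousLinearEquiv.toContinuousLinearMap).comp
        (M.quotient Z k).orthogonalProjectionOnto)) hy fun b hb => by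
    have hbk : b < k := lt_of_le_of_lt hb ha
    have h1 := hV ⟨(b, y), hbk, hy, hy0⟩
    have h2 := Submodule.orthogonalProjectionOnto_mem_subspace_eq_self
      (v ⟨(b, y), hbk, hy, hy0⟩)
    have h3 := congrArg Subtype.val h1
    rw [← h2] at h3
    exact h3
  have hl : ⟪V (M.quotientAct Z k f h), v' ⟨(a, y), ha, hy, hy0⟩⟫_ℂ =
      ⟪(h : H), (dirDeriv e₀)^[a]
        (fun y => star (M.toFun (M.incl f) (e.symm (star y))) • S y) y⟫_ℂ := by
    rw [← hV, V.inner_map_map, QuasiFreeModule.quotientAct,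
      Submodule.inner_orthogonalProjectionOnto_eq_of_mem_right]
    exact hS.inner_act_iterate hM he hball f h a hy
  have hr' : ⟪M'.quotientAct Z k f (V h), v' ⟨(a, y), ha, hy, hy0⟩⟫_ℂ =
      ⟪(V h : H'), (dirDeriv e₀)^[a]
        (fun y => star (M.toFun (M.incl f) (e.symm (star y))) • S' y) y⟫_ℂ := by
    rw [QuasiFreeModule.quotientAct, Submodule.inner_orthogonalProjectionOnto_eq_of_mem_right,
      toFun_incl_eq M M']
    exact hS'.inner_act_iterate hM' he hball f (V h) a hy
  rw [inner_sub_left, hl, hr', ← hclm, sub_eq_zero,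
    ← Submodule.inner_orthogonalProjectionOnto_eq_of_mem_left, ← V.inner_map_map]
  rfl

end Quotient

/-! ### The ideal of vanishing mixed jets and its relation to 𝒟_k. -/

section JetVanish

variable {n k : ℕ} {q : Fin (n + 1) → ℂ} {r : ℝ}

/-- The product of a polydisc with its conjugate. -/
abbrev box (q : Fin (n + 1) → ℂ) (r : ℝ) : Set ((Fin (n + 1) → ℂ) × (Fin (n + 1) → ℂ)) :=
  ball q r ×ˢ ball (star q) r

theorem isOpen_box : IsOpen (box q r) := isOpen_ball.prod isOpen_ball

theorem box_eq_ball : box q r = ball (q, star q) r := ball_prod_same _ _ _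

theorem mk_star_mem_box {x : Fin (n + 1) → ℂ} (hx : x ∈ ball q r) : (x, star x) ∈ box q r :=
  ⟨hx, star_mem_ball_star.2 hx⟩

/-- The mixed derivative `∂_{y_i}^b ∂_{x_j}^a` of a function of `(x, y)`. -/
def mixedDeriv (i : Fin (n + 1)) (b : ℕ) (j : Fin (n + 1)) (a : ℕ)
    (f : (Fin (n + 1) → ℂ) × (Fin (n + 1) → ℂ) → ℂ) :
    (Fin (n + 1) → ℂ) × (Fin (n + 1) → ℂ) → ℂ :=
  (dirDeriv (0, Pi.single i 1))^[b] ((dirDeriv (Pi.single j 1, 0))^[a] f)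

variable {f g : (Fin (n + 1) → ℂ) × (Fin (n + 1) → ℂ) → ℂ}

theorem differentiableOn_mixedDeriv (hf : DifferentiableOn ℂ f (box q r)) (i j : Fin (n + 1))
    (b a : ℕ) : DifferentiableOn ℂ (mixedDeriv i b j a f) (box q r) :=
  differentiableOn_iterate_dirDeriv isOpen_box
    (differentiableOn_iterate_dirDeriv isOpen_box hf a) b

theorem mixedDeriv_congr (h : EqOn f g (box q r)) (i j : Fin (n + 1)) (b a : ℕ) :
    EqOn (mixedDeriv i b j a f) (mixedDeriv i b j a g) (box q r) :=
  iterate_dirDeriv_congr isOpen_box (iterate_dirDeriv_congr isOpen_box h a) b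

theorem mixedDeriv_add (hf : DifferentiableOn ℂ f (box q r)) (hg : DifferentiableOn ℂ g (box q r))
    (i j : Fin (n + 1)) (b a : ℕ) :
    EqOn (mixedDeriv i b j a fun p => f p + g p)
      (fun p => mixedDeriv i b j a f p + mixedDeriv i b j a g p) (box q r) :=
  (iterate_dirDeriv_congr isOpen_box (iterate_dirDeriv_add isOpen_box hf hg a) b).trans
    (iterate_dirDeriv_add isOpen_box (differentiableOn_iterate_dirDeriv isOpen_box hf a)
      (differentiableOn_iterate_dirDeriv isOpen_box hg a) b)

theorem mixedDeriv_sub (hf : DifferentiableOn ℂ f (box q r)) (hg : DifferentiableOn ℂ g (box q r))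
    (i j : Fin (n + 1)) (b a : ℕ) :
    EqOn (mixedDeriv i b j a fun p => f p - g p)
      (fun p => mixedDeriv i b j a f p - mixedDeriv i b j a g p) (box q r) :=
  (iterate_dirDeriv_congr isOpen_box (iterate_dirDeriv_sub isOpen_box hf hg a) b).trans
    (iterate_dirDeriv_sub isOpen_box (differentiableOn_iterate_dirDeriv isOpen_box hf a)
      (differentiableOn_iterate_dirDeriv isOpen_box hg a) b)

theorem dirDeriv_fst_comp_snd {A : (Fin (n + 1) → ℂ) → ℂ}
    (hA : DifferentiableOn ℂ A (ball (star q) r)) (v : Fin (n + 1) → ℂ) :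
    EqOn (dirDeriv (v, 0) fun p : (Fin (n + 1) → ℂ) × (Fin (n + 1) → ℂ) => A p.2)
      (fun _ => 0) (box q r) := fun p hp => by
  have h := (hA.differentiableAt (isOpen_ball.mem_nhds hp.2)).hasFDerivAt.comp p
    (hasFDerivAt_snd (𝕜 := ℂ) (p := p))
  have h' : fderiv ℂ (fun p : (Fin (n + 1) → ℂ) × (Fin (n + 1) → ℂ) => A p.2) p = _ := h.fderiv
  rw [dirDeriv, h']
  simp

theorem dirDeriv_snd_comp_fst {A : (Fin (n + 1) → ℂ) → ℂ}
    (hA : DifferentiableOn ℂ A (ball q r)) (v : Fin (n + 1) → ℂ) :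
    EqOn (dirDeriv (0, v) fun p : (Fin (n + 1) → ℂ) × (Fin (n + 1) → ℂ) => A p.1)
      (fun _ => 0) (box q r) := fun p hp => by
  have h := (hA.differentiableAt (isOpen_ball.mem_nhds hp.1)).hasFDerivAt.comp p
    (hasFDerivAt_fst (𝕜 := ℂ) (p := p))
  have h' : fderiv ℂ (fun p : (Fin (n + 1) → ℂ) × (Fin (n + 1) → ℂ) => A p.1) p = _ := h.fderiv
  rw [dirDeriv, h']
  simp

theorem mixedDeriv_comp_snd {A : (Fin (n + 1) → ℂ) → ℂ}
    (hA : DifferentiableOn ℂ A (ball (star q) r)) (i j : Fin (n + 1)) (b a : ℕ) :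
    EqOn (mixedDeriv i b j (a + 1) fun p => A p.2) (fun _ => 0) (box q r) := by
  have h := iterate_dirDeriv_congr (v := (0, Pi.single i 1)) isOpen_box
    (iterate_dirDeriv_congr (v := (Pi.single j 1, 0)) isOpen_box
      (dirDeriv_fst_comp_snd hA (Pi.single j 1)) a) b
  rwa [iterate_dirDeriv_zero, iterate_dirDeriv_zero] at h

theorem mixedDeriv_comp_fst {A : (Fin (n + 1) → ℂ) → ℂ}
    (hA : DifferentiableOn ℂ A (ball q r)) (i j : Fin (n + 1)) (b a : ℕ) :
    EqOn (mixedDeriv i (b + 1) j a fun p => A p.1) (fun _ => 0) (box q r) := by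
  have hA' : DifferentiableOn ℂ (fun p : (Fin (n + 1) → ℂ) × (Fin (n + 1) → ℂ) => A p.1)
      (box q r) := hA.comp differentiableOn_fst fun p hp => hp.1
  have h := (dirDeriv_iterate_comm (v := (Pi.single j 1, 0)) (w := (0, Pi.single i 1))
    isOpen_box hA' a).trans (iterate_dirDeriv_congr isOpen_box
      (dirDeriv_snd_comp_fst hA (Pi.single i 1)) a)
  have h' := iterate_dirDeriv_congr (v := (0, Pi.single i 1)) isOpen_box h b
  rwa [iterate_dirDeriv_zero, iterate_dirDeriv_zero] at h'

/-- `f` lies, near the slice, in the ideal generated by `x₀ ^ k` and `y₀ ^ k`. -/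
def JetVanish (k : ℕ) (q : Fin (n + 1) → ℂ) (r : ℝ)
    (f : (Fin (n + 1) → ℂ) × (Fin (n + 1) → ℂ) → ℂ) : Prop :=
  ∀ a < k, ∀ b < k, ∀ p ∈ box q r, p.1 0 = 0 → p.2 0 = 0 → mixedDeriv 0 b 0 a f p = 0

theorem JetVanish.congr (hf : JetVanish k q r f) (h : EqOn g f (box q r)) : JetVanish k q r g :=
  fun a ha b hb p hp h1 h2 => by
    rw [mixedDeriv_congr h _ _ _ _ hp]; exact hf a ha b hb p hp h1 h2

theorem JetVanish.mono (hf : JetVanish k q r f) {r' : ℝ} (h : r' ≤ r) : JetVanish k q r' f :=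
  fun a ha b hb p hp => hf a ha b hb p
    ⟨ball_subset_ball h hp.1, ball_subset_ball h hp.2⟩

theorem JetVanish.smul (h : JetVanish k q r f) (hf : DifferentiableOn ℂ f (box q r))
    (hg : DifferentiableOn ℂ g (box q r)) : JetVanish k q r fun p => g p • f p :=
  fun a ha b hb p hp h1 h2 => iterate_dirDeriv_iterate_smul_eq_zero isOpen_box hg hf hp
    fun b' hb' a' ha' => h a' (by omega) b' (by omega) p hp h1 h2

/-- As φ(0) = 0, φ(f) is f times the holomorphic function `dslope φ 0 (f)`, and the jet condition is
stable under such multiplication. -/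
theorem JetVanish.comp (h : JetVanish k q r f) (hf : DifferentiableOn ℂ f (box q r))
    {φ : ℂ → ℂ} {O : Set ℂ} (hO : IsOpen O) (h0 : (0 : ℂ) ∈ O) (hφ : DifferentiableOn ℂ φ O)
    (hφ0 : φ 0 = 0) (hmaps : MapsTo f (box q r) O) : JetVanish k q r fun p => φ (f p) := by
  have hd := (Complex.differentiableOn_dslope (hO.mem_nhds h0)).2 hφ
  refine (h.smul hf (hd.comp hf hmaps)).congr fun p _ => ?_
  have := sub_smul_dslope φ 0 (f p)
  rw [hφ0, sub_zero, sub_zero] at this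
  rw [← this, smul_eq_mul, mul_comm]
  rfl

theorem dirDeriv_eq_zero_of_slice (hf : DifferentiableOn ℂ f (box q r))
    (h : ∀ p ∈ box q r, p.1 0 = 0 → p.2 0 = 0 → f p = 0)
    {v : (Fin (n + 1) → ℂ) × (Fin (n + 1) → ℂ)} (hv1 : v.1 0 = 0) (hv2 : v.2 0 = 0) :
    ∀ p ∈ box q r, p.1 0 = 0 → p.2 0 = 0 → dirDeriv v f p = 0 := by
  intro p hp h1 h2
  have hd := deriv_line (f := f) (z := p) (v := v) (t := 0)
    (hf.differentiableAt (isOpen_box.mem_nhds (by simpa using hp)))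
  rw [zero_smul, add_zero] at hd
  have hc : Tendsto (fun t : ℂ => p + t • v) (𝓝 0) (𝓝 p) :=
    Continuous.tendsto' (by fun_prop) _ _ (by simp)
  have hev : (fun t : ℂ => f (p + t • v)) =ᶠ[𝓝 0] fun _ => 0 := by
    filter_upwards [hc.eventually (isOpen_box.mem_nhds hp)] with t ht
    exact h _ ht (by simp [h1, hv1]) (by simp [h2, hv2])
  rw [← hd, hev.deriv_eq, deriv_const]

/-- The coordinate index and the order (minus one) of the operators heading the rows and columns
of `𝒟_k`. -/
def opIndex : Fin n ⊕ Fin (k - 1) → Fin (n + 1) × ℕ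
  | Sum.inl j => (j.succ, 0)
  | Sum.inr b => (0, b)

theorem diffArray_eq_mixedDeriv {F : (Fin (n + 1) → ℂ) → ℂ}
    {Φ : (Fin (n + 1) → ℂ) × (Fin (n + 1) → ℂ) → ℂ} (hΦ : DifferentiableOn ℂ Φ (box q r))
    (h : ∀ x ∈ ball q r, F x = Φ (x, star x)) {x : Fin (n + 1) → ℂ} (hx : x ∈ ball q r)
    (i j : Fin n ⊕ Fin (k - 1)) :
    diffArray k F x i j = mixedDeriv (opIndex i).1 ((opIndex i).2 + 1) (opIndex j).1
      ((opIndex j).2 + 1) Φ (x, star x) := by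
  have hcol : colOp j F = (del (opIndex j).1)^[(opIndex j).2 + 1] F := by
    cases j <;> rfl
  have hrow : ∀ G, rowOp i G = (delBar (opIndex i).1)^[(opIndex i).2 + 1] G := fun G => by
    cases i <;> rfl
  rw [diffArray, Matrix.of_apply, hcol, hrow]
  exact iterate_delBar_antidiag (differentiableOn_iterate_dirDeriv isOpen_box hΦ _)
    (iterate_del_antidiag hΦ h _ _) _ _ hx

/-- Normal orders stay below k, and tangential derivatives of functions vanishing on the slice
vanish there too. The hypothesis on k provides the vanishing in order zero. -/
theorem JetVanish.mixedDeriv_opIndex_eq_zero (h : JetVanish k q r f) (hk : 1 ≤ k)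
    (hf : DifferentiableOn ℂ f (box q r)) (i j : Fin n ⊕ Fin (k - 1)) :
    ∀ p ∈ box q r, p.1 0 = 0 → p.2 0 = 0 → mixedDeriv (opIndex i).1 ((opIndex i).2 + 1)
      (opIndex j).1 ((opIndex j).2 + 1) f p = 0 := by
  have hsucc : ∀ j : Fin n, (Pi.single j.succ 1 : Fin (n + 1) → ℂ) 0 = 0 := fun j => by simp
  intro p hp h1 h2
  rcases i with i | i <;> rcases j with j | j
  · refine dirDeriv_eq_zero_of_slice (differentiableOn_dirDeriv isOpen_box hf _) ?_
      rfl (hsucc i) p hp h1 h2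
    exact dirDeriv_eq_zero_of_slice hf (fun p hp h1 h2 => h 0 hk 0 hk p hp h1 h2) (hsucc j) rfl
  · refine dirDeriv_eq_zero_of_slice (differentiableOn_iterate_dirDeriv isOpen_box hf (j + 1)) ?_
      rfl (hsucc i) p hp h1 h2
    exact fun p hp h1 h2 => h (j + 1) (by omega) 0 hk p hp h1 h2
  · refine (dirDeriv_iterate_comm (v := (0, Pi.single 0 1)) (w := (Pi.single j.succ 1, 0))
      isOpen_box hf (i + 1) hp).symm.trans ?_
    refine dirDeriv_eq_zero_of_slice (differentiableOn_iterate_dirDeriv isOpen_box hf (i + 1)) ?_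
      (hsucc j) rfl p hp h1 h2
    exact fun p hp h1 h2 => h 0 hk (i + 1) (by omega) p hp h1 h2
  · exact h (j + 1) (by omega) (i + 1) (by omega) p hp h1 h2

/-- Functions of `x` and functions of `y` do not contribute to `𝒟_k`. -/
theorem mixedDeriv_separated {A B : (Fin (n + 1) → ℂ) → ℂ}
    (hA : DifferentiableOn ℂ A (ball q r)) (hB : DifferentiableOn ℂ B (ball (star q) r))
    (hf : DifferentiableOn ℂ f (box q r)) (i j : Fin (n + 1)) (b a : ℕ) :
    EqOn (mixedDeriv i (b + 1) j (a + 1) fun p => f p + (A p.1 + B p.2))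
      (mixedDeriv i (b + 1) j (a + 1) f) (box q r) := fun p hp => by
  have hA' : DifferentiableOn ℂ (fun p : (Fin (n + 1) → ℂ) × (Fin (n + 1) → ℂ) => A p.1)
      (box q r) := hA.comp differentiableOn_fst fun p hp => hp.1
  have hB' : DifferentiableOn ℂ (fun p : (Fin (n + 1) → ℂ) × (Fin (n + 1) → ℂ) => B p.2)
      (box q r) := hB.comp differentiableOn_snd fun p hp => hp.2
  rw [mixedDeriv_add hf (g := fun p => A p.1 + B p.2) (hA'.fun_add hB') i j _ _ hp]
  simp only
  rw [mixedDeriv_add hA' hB' i j _ _ hp]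
  simp only
  rw [mixedDeriv_comp_fst hA i j b (a + 1) hp, mixedDeriv_comp_snd hB i j (b + 1) a hp]
  simp

theorem eq_of_dirDeriv_line_eq_zero {E : Type*} [NormedAddCommGroup E] [NormedSpace ℂ E]
    {U : Set E} (hU : IsOpen U) {f : E → ℂ} (hf : DifferentiableOn ℂ f U) {z v : E}
    (hconv : Convex ℝ ((fun t : ℂ => z + t • v) ⁻¹' U)) (hz : z ∈ U) (hzv : z + v ∈ U)
    (h : ∀ t : ℂ, z + t • v ∈ U → dirDeriv v f (z + t • v) = 0) : f (z + v) = f z := by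
  have hline : Differentiable ℂ (fun t : ℂ => z + t • v) := by fun_prop
  have hopen : IsOpen ((fun t : ℂ => z + t • v) ⁻¹' U) := hU.preimage hline.continuous
  have := hopen.is_const_of_deriv_eq_zero hconv.isPreconnected
    (hf.comp hline.differentiableOn fun t ht => ht) (fun t ht => by
      have h1 := deriv_line (hf.differentiableAt (hU.mem_nhds ht))
      simp only [Function.comp_def]
      rw [h1]
      exact h t ht)
    (show (1 : ℂ) ∈ _ by simpa using hzv) (show (0 : ℂ) ∈ _ by simpa using hz)
  simpa using this

theorem dirDeriv_sum_smul {E ι : Type*} [NormedAddCommGroup E] [NormedSpace ℂ E] (s : Finset ι)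
    (f : E → ℂ) (z : E) (c : ι → ℂ) (w : ι → E) :
    dirDeriv (∑ i ∈ s, c i • w i) f z = ∑ i ∈ s, c i * dirDeriv (w i) f z := by
  simp [dirDeriv]

theorem eq_sum_single {v : Fin (n + 1) → ℂ} (hv : v 0 = 0) :
    v = ∑ j : Fin n, v j.succ • (Pi.single j.succ 1 : Fin (n + 1) → ℂ) := by
  conv_lhs => rw [pi_eq_sum_univ' v]
  rw [Fin.sum_univ_succ, hv, zero_smul, zero_add]

/-- The segment from `star q` to `y` stays in the slice, and its direction only involves tangential
coordinates. -/
theorem eq_of_dirDeriv_snd_eq_zero (hf : DifferentiableOn ℂ f (box q r)) (hr : 0 < r)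
    (hq : q 0 = 0) (h : ∀ j : Fin n, ∀ p ∈ box q r, p.1 0 = 0 → p.2 0 = 0 →
      dirDeriv (0, Pi.single j.succ 1) f p = 0)
    {x y : Fin (n + 1) → ℂ} (hx : x ∈ ball q r) (hy : y ∈ ball (star q) r) (hx0 : x 0 = 0)
    (hy0 : y 0 = 0) : f (x, y) = f (x, star q) := by
  have hv0 : (y - star q) 0 = 0 := by simp [hy0, hq]
  have e : (x, y) = (x, star q) + (0, y - star q) := by simp
  have hv : ((0, y - star q) : (Fin (n + 1) → ℂ) × (Fin (n + 1) → ℂ)) =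
      ∑ j : Fin n, (y - star q) j.succ •
        ((0, Pi.single j.succ 1) : (Fin (n + 1) → ℂ) × (Fin (n + 1) → ℂ)) := by
    refine Prod.ext ?_ ?_
    · simp [Prod.fst_sum]
    · rw [Prod.snd_sum]
      exact eq_sum_single hv0
  rw [e]
  refine eq_of_dirDeriv_line_eq_zero isOpen_box hf
    ((convex_preimage_line (convex_ball q r) x 0).inter
      (convex_preimage_line (convex_ball (star q) r) (star q) (y - star q)))
    ⟨hx, mem_ball_self hr⟩ (by rw [← e]; exact ⟨hx, hy⟩) fun t ht => ?_
  rw [hv, dirDeriv_sum_smul]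
  refine Finset.sum_eq_zero fun j _ => ?_
  rw [← hv, h j _ ht (by simp [hx0]) (by simp [hy0, hq]), mul_zero]

theorem eq_of_dirDeriv_fst_eq_zero (hf : DifferentiableOn ℂ f (box q r)) (hr : 0 < r)
    (hq : q 0 = 0) (h : ∀ j : Fin n, ∀ p ∈ box q r, p.1 0 = 0 → p.2 0 = 0 →
      dirDeriv (Pi.single j.succ 1, 0) f p = 0)
    {x y : Fin (n + 1) → ℂ} (hx : x ∈ ball q r) (hy : y ∈ ball (star q) r) (hx0 : x 0 = 0)
    (hy0 : y 0 = 0) : f (x, y) = f (q, y) := by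
  have hv0 : (x - q) 0 = 0 := by simp [hx0, hq]
  have e : (x, y) = (q, y) + (x - q, 0) := by simp
  have hv : ((x - q, 0) : (Fin (n + 1) → ℂ) × (Fin (n + 1) → ℂ)) =
      ∑ j : Fin n, (x - q) j.succ •
        ((Pi.single j.succ 1, 0) : (Fin (n + 1) → ℂ) × (Fin (n + 1) → ℂ)) := by
    refine Prod.ext ?_ ?_
    · rw [Prod.fst_sum]
      exact eq_sum_single hv0
    · simp [Prod.snd_sum]
  rw [e]
  refine eq_of_dirDeriv_line_eq_zero isOpen_box hf
    ((convex_preimage_line (convex_ball q r) q (x - q)).inter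
      (convex_preimage_line (convex_ball (star q) r) y 0))
    ⟨mem_ball_self hr, hy⟩ (by rw [← e]; exact ⟨hx, hy⟩) fun t ht => ?_
  rw [hv, dirDeriv_sum_smul]
  refine Finset.sum_eq_zero fun j _ => ?_
  rw [← hv, h j _ ht (by simp [hx0, hq]) (by simp [hy0]), mul_zero]

/-- `W` is a union of complex lines parallel to `v`. With `W` given by y = `star q` or x = q, the
normalisation at the centre kills pure derivatives of every order. -/
theorem iterate_dirDeriv_eq_zero_of_line {E : Type*} [NormedAddCommGroup E] [NormedSpace ℂ E]
    [FiniteDimensional ℂ E] {U W : Set E} (hU : IsOpen U) {f : E → ℂ}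
    (hf : DifferentiableOn ℂ f U) {v : E} (hW : ∀ z ∈ W, ∀ t : ℂ, z + t • v ∈ W)
    (h : ∀ z ∈ U, z ∈ W → f z = 0) (a : ℕ) :
    ∀ z ∈ U, z ∈ W → (dirDeriv v)^[a] f z = 0 := by
  induction a generalizing f with
  | zero => exact h
  | succ a ih =>
    refine ih (differentiableOn_dirDeriv hU hf v) fun z hz hzW => ?_
    have hd := deriv_line (f := f) (z := z) (v := v) (t := 0)
      (hf.differentiableAt (hU.mem_nhds (by simpa using hz)))
    rw [zero_smul, add_zero] at hd
    have hc : Tendsto (fun t : ℂ => z + t • v) (𝓝 0) (𝓝 z) :=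
      Continuous.tendsto' (by fun_prop) _ _ (by simp)
    have hev : (fun t : ℂ => f (z + t • v)) =ᶠ[𝓝 0] fun _ => 0 := by
      filter_upwards [hc.eventually (hU.mem_nhds hz)] with t ht
      exact h _ ht (hW z hzW t)
    rw [← hd, hev.deriv_eq, deriv_const]

/-- A function normalised at the centre and annihilated by `𝒟_k` on the slice has vanishing
jets. -/
theorem jetVanish_of_mixedDeriv_opIndex_eq_zero (hf : DifferentiableOn ℂ f (box q r)) (hr : 0 < r)
    (hq : q 0 = 0) (hx : ∀ x ∈ ball q r, f (x, star q) = 0)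
    (hy : ∀ y ∈ ball (star q) r, f (q, y) = 0)
    (h : ∀ i j : Fin n ⊕ Fin (k - 1), ∀ p ∈ box q r, p.1 0 = 0 → p.2 0 = 0 →
      mixedDeriv (opIndex i).1 ((opIndex i).2 + 1) (opIndex j).1 ((opIndex j).2 + 1) f p = 0) :
    JetVanish k q r f := by
  have hxD : ∀ (j : Fin (n + 1)) (a : ℕ), ∀ x ∈ ball q r,
      (dirDeriv (Pi.single j 1, 0))^[a] f (x, star q) = 0 := fun j a x hxm =>
    iterate_dirDeriv_eq_zero_of_line isOpen_box
      (W := {p : (Fin (n + 1) → ℂ) × (Fin (n + 1) → ℂ) | p.2 = star q}) hf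
      (fun z hz t => by simpa using hz)
      (fun z hz hzW => by
        have := hx z.1 hz.1
        rwa [← show z.2 = star q from hzW] at this) a (x, star q) ⟨hxm, mem_ball_self hr⟩ rfl
  have hyD : ∀ (j : Fin (n + 1)) (a : ℕ), ∀ y ∈ ball (star q) r,
      (dirDeriv (0, Pi.single j 1))^[a] f (q, y) = 0 := fun j a y hym =>
    iterate_dirDeriv_eq_zero_of_line isOpen_box
      (W := {p : (Fin (n + 1) → ℂ) × (Fin (n + 1) → ℂ) | p.1 = q}) hf
      (fun z hz t => by simpa using hz)
      (fun z hz hzW => by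
        have := hy z.2 hz.2
        rwa [← show z.1 = q from hzW] at this) a (q, y) ⟨mem_ball_self hr, hym⟩ rfl
  rintro a ha b hb ⟨x, y⟩ ⟨hxm, hym⟩ hx0 hy0
  -- Only the case of two positive orders is an entry of 𝒟_k. If one order is zero, a tangential
  -- entry allows moving that variable to the centre; if both are zero, this is done twice.
  rcases a with - | a <;> rcases b with - | b
  · refine (eq_of_dirDeriv_fst_eq_zero hf hr hq (fun j p hp h1 h2 => ?_) hxm hym hx0 hy0).trans
      (hy y hym)
    refine (eq_of_dirDeriv_snd_eq_zero (differentiableOn_dirDeriv isOpen_box hf _) hr hq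
      (fun i p hp h1 h2 => ?_) hp.1 hp.2 h1 h2).trans (hxD j.succ 1 p.1 hp.1)
    exact h (Sum.inl i) (Sum.inl j) p hp h1 h2
  · refine (eq_of_dirDeriv_fst_eq_zero (differentiableOn_iterate_dirDeriv isOpen_box hf (b + 1))
      hr hq (fun j p hp h1 h2 => ?_) hxm hym hx0 hy0).trans (hyD 0 (b + 1) y hym)
    refine (dirDeriv_iterate_comm isOpen_box hf (b + 1) hp).trans ?_
    exact h (Sum.inr ⟨b, by omega⟩) (Sum.inl j) p hp h1 h2
  · refine (eq_of_dirDeriv_snd_eq_zero (differentiableOn_iterate_dirDeriv isOpen_box hf (a + 1))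
      hr hq (fun j p hp h1 h2 => ?_) hxm hym hx0 hy0).trans (hxD 0 (a + 1) x hxm)
    exact h (Sum.inl j) (Sum.inr ⟨a, by omega⟩) p hp h1 h2
  · exact h (Sum.inr ⟨b, by omega⟩) (Sum.inr ⟨a, by omega⟩) (x, y) ⟨hxm, hym⟩ hx0 hy0

end JetVanish

/-! ### The polarised metric as generating function of the Gram matrix. -/

section Kernel

variable {n k : ℕ} {q : Fin (n + 1) → ℂ} {r : ℝ} {H H' : Type*} [NormedAddCommGroup H]
  [InnerProductSpace ℂ H] [NormedAddCommGroup H'] [InnerProductSpace ℂ H']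
  {S : (Fin (n + 1) → ℂ) → H} {S' : (Fin (n + 1) → ℂ) → H'}

/-- The polarised metric of a local frame. -/
def polarKernel (S : (Fin (n + 1) → ℂ) → H) :
    (Fin (n + 1) → ℂ) × (Fin (n + 1) → ℂ) → ℂ := fun p => ⟪S (star p.1), S p.2⟫_ℂ

theorem differentiableOn_polarKernel (hS : DifferentiableOn ℂ S (ball (star q) r)) :
    DifferentiableOn ℂ (polarKernel S) (box q r) :=
  differentiableOn_pairing (differentiableOn_conjDual hS) hS

theorem mixedDeriv_polarKernel [CompleteSpace H] (hS : DifferentiableOn ℂ S (ball (star q) r))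
    (b a : ℕ) :
    EqOn (mixedDeriv 0 b 0 a (polarKernel S))
      (fun p => ⟪(dirDeriv e₀)^[a] S (star p.1), (dirDeriv e₀)^[b] S p.2⟫_ℂ) (box q r) :=
  fun p hp => by
    refine (iterate_dirDeriv_pairing isOpen_ball isOpen_ball (differentiableOn_conjDual hS) hS
      e₀ e₀ a b hp).trans ?_
    simp only
    rw [iterate_dirDeriv_conjDual hS a hp.1, IsLocalFrame.star_e₀]
    rfl

/-- Mixed normal derivatives of κ are inner products of jets at independent points of the slice. -/
theorem jetVanish_polarKernel_sub_iff [CompleteSpace H] [CompleteSpace H']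
    (hS : DifferentiableOn ℂ S (ball (star q) r)) (hS' : DifferentiableOn ℂ S' (ball (star q) r)) :
    JetVanish k q r (fun p => polarKernel S p - polarKernel S' p) ↔
      ∀ a < k, ∀ b < k, ∀ y ∈ ball (star q) r, ∀ y' ∈ ball (star q) r, y 0 = 0 → y' 0 = 0 →
        ⟪(dirDeriv e₀)^[a] S y, (dirDeriv e₀)^[b] S y'⟫_ℂ =
          ⟪(dirDeriv e₀)^[a] S' y, (dirDeriv e₀)^[b] S' y'⟫_ℂ := by
  have key : ∀ a b, ∀ p ∈ box q r,
      (mixedDeriv 0 b 0 a (fun p => polarKernel S p - polarKernel S' p) p = 0 ↔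
        ⟪(dirDeriv e₀)^[a] S (star p.1), (dirDeriv e₀)^[b] S p.2⟫_ℂ =
          ⟪(dirDeriv e₀)^[a] S' (star p.1), (dirDeriv e₀)^[b] S' p.2⟫_ℂ) := fun a b p hp => by
    rw [mixedDeriv_sub (differentiableOn_polarKernel hS) (differentiableOn_polarKernel hS')
      0 0 b a hp]
    simp only
    rw [mixedDeriv_polarKernel hS b a hp, mixedDeriv_polarKernel hS' b a hp, sub_eq_zero]
  constructor
  · intro h a ha b hb y hy y' hy' hy0 hy0'
    have hp : (star y, y') ∈ box q r := ⟨mem_ball_star.1 hy, hy'⟩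
    have := (key a b _ hp).1 (h a ha b hb _ hp (by simp [hy0]) hy0')
    simpa only [star_star] using this
  · intro h a ha b hb p hp h1 h2
    exact (key a b p hp).2 (h a ha b hb _ (star_mem_ball_star.2 hp.1) _ hp.2 (by simp [h1]) h2)

theorem polarKernel_antidiag (S : (Fin (n + 1) → ℂ) → H) (x : Fin (n + 1) → ℂ) :
    polarKernel S (x, star x) = ((‖S (star x)‖ ^ 2 : ℝ) : ℂ) := by
  simp [polarKernel, inner_self_eq_norm_sq_to_K]

theorem polarKernel_smul (S : (Fin (n + 1) → ℂ) → H) (χ : (Fin (n + 1) → ℂ) → ℂ)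
    (p : (Fin (n + 1) → ℂ) × (Fin (n + 1) → ℂ)) :
    polarKernel (fun y => χ y • S y) p = star (χ (star p.1)) * χ p.2 * polarKernel S p := by
  simp only [polarKernel, inner_smul_left, inner_smul_right, Complex.star_def]
  ring

theorem star_polarKernel (S : (Fin (n + 1) → ℂ) → H) (x y : Fin (n + 1) → ℂ) :
    star (polarKernel S (x, y)) = polarKernel S (star y, star x) := by
  simp [polarKernel]

end Kernel

/-! ### Passing between kernels and logarithms of metrics. -/

section Main

variable {n k : ℕ} {Ω Z : Set (Fin (n + 1) → ℂ)}
  {e : OpenPartialHomeomorph (Fin (n + 1) → ℂ) (Fin (n + 1) → ℂ)}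
  {q : Fin (n + 1) → ℂ} {r : ℝ}
  {H H' : Type*} [NormedAddCommGroup H] [InnerProductSpace ℂ H]
  [NormedAddCommGroup H'] [InnerProductSpace ℂ H']
  {S : (Fin (n + 1) → ℂ) → H} {S' : (Fin (n + 1) → ℂ) → H'}

theorem exists_box_subset {U : Set ((Fin (n + 1) → ℂ) × (Fin (n + 1) → ℂ))} (hr : 0 < r)
    (hU : ∀ᶠ p in 𝓝 (q, star q), p ∈ U) : ∃ δ > 0, δ ≤ r ∧ box q δ ⊆ U := by
  obtain ⟨δ, hδ, h⟩ := Metric.mem_nhds_iff.1 hU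
  refine ⟨min δ r, lt_min hδ hr, min_le_right _ _, ?_⟩
  rw [box_eq_ball]
  exact (ball_subset_ball (min_le_left _ _)).trans h

theorem log_add_star_log (w : ℂ) :
    Complex.log w + star (Complex.log w) = ((2 * Real.log ‖w‖ : ℝ) : ℂ) := by
  rw [Complex.star_def, Complex.add_conj, Complex.log_re]

/-- If the jets of `S` and of `χ • S'` have the same Gram matrix, then `𝒟_k` annihilates the
logarithm of the quotient of the metrics at the centre. -/
theorem diffArray_log_eq_zero [CompleteSpace H] [CompleteSpace H'] (hk : 1 ≤ k) (hr : 0 < r)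
    (hq : q 0 = 0) (hS : DifferentiableOn ℂ S (ball (star q) r))
    (hS' : DifferentiableOn ℂ S' (ball (star q) r)) (hS0 : ∀ y ∈ ball (star q) r, S y ≠ 0)
    (hS0' : ∀ y ∈ ball (star q) r, S' y ≠ 0) {χ : (Fin (n + 1) → ℂ) → ℂ}
    (hχ : DifferentiableOn ℂ χ (ball (star q) r))
    (h : JetVanish k q r fun p => polarKernel S p - polarKernel (fun y => χ y • S' y) p)
    {F : (Fin (n + 1) → ℂ) → ℂ}
    (hF : ∀ x ∈ ball q r, F x = ((Real.log (‖S' (star x)‖ ^ 2 / ‖S (star x)‖ ^ 2) : ℝ) : ℂ)) :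
    diffArray k F q = 0 := by
  have hqm : (q, star q) ∈ box q r := mk_star_mem_box (mem_ball_self hr)
  have hqs : star q ∈ ball (star q) r := hqm.2
  set κ := polarKernel S with hκ
  set κ' := polarKernel (fun y => χ y • S' y) with hκ'
  have hχS : DifferentiableOn ℂ (fun y => χ y • S' y) (ball (star q) r) := hχ.fun_smul hS'
  have hκd : DifferentiableOn ℂ κ (box q r) := differentiableOn_polarKernel hS
  have hκd' : DifferentiableOn ℂ κ' (box q r) := differentiableOn_polarKernel hχS
  have heq : κ (q, star q) = κ' (q, star q) := by
    have := h 0 hk 0 hk _ hqm hq (by simp [hq])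
    exact sub_eq_zero.1 this
  have hκ0 : κ (q, star q) ≠ 0 := by
    rw [hκ, polarKernel_antidiag]
    have := norm_pos_iff.2 (hS0 _ hqs)
    exact_mod_cast (pow_pos this 2).ne'
  -- χ is not assumed zero-free: equality of the Gram entries of order zero at the centre forces it
  -- there, and a smaller polydisc suffices.
  have hχ0 : χ (star q) ≠ 0 := fun h0 => hκ0 (by
    rw [heq, hκ', polarKernel_smul, h0, mul_zero, zero_mul])
  have hev : ∀ᶠ p in 𝓝 (q, star q), p ∈ {p : (Fin (n + 1) → ℂ) × (Fin (n + 1) → ℂ) |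
      κ' p ≠ 0 ∧ κ p * (κ' p)⁻¹ ∈ Complex.slitPlane ∧ χ p.2 ≠ 0 ∧
        χ p.2 * (χ (star q))⁻¹ ∈ Complex.slitPlane} := by
    have c1 : ContinuousAt κ (q, star q) := hκd.continuousOn.continuousAt (isOpen_box.mem_nhds hqm)
    have c2 : ContinuousAt κ' (q, star q) :=
      hκd'.continuousOn.continuousAt (isOpen_box.mem_nhds hqm)
    have c3 : ContinuousAt (fun p : (Fin (n + 1) → ℂ) × (Fin (n + 1) → ℂ) => χ p.2)
        (q, star q) := ContinuousAt.comp (f := Prod.snd) (g := χ)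
      (hχ.continuousOn.continuousAt (isOpen_ball.mem_nhds hqs)) continuousAt_snd
    have hκ0' : κ' (q, star q) ≠ 0 := heq ▸ hκ0
    filter_upwards [c2.eventually_ne hκ0',
      (c1.mul (c2.inv₀ hκ0')).eventually_mem (Complex.isOpen_slitPlane.mem_nhds (by
        simp only [Pi.mul_apply, Pi.inv_apply]
        rw [heq, mul_inv_cancel₀ hκ0']
        exact Complex.one_mem_slitPlane)),
      c3.eventually_ne hχ0, (c3.mul (continuousAt_const (y := (χ (star q))⁻¹))).eventually_mem
        (Complex.isOpen_slitPlane.mem_nhds (by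
          change χ (star q) * (χ (star q))⁻¹ ∈ Complex.slitPlane
          rw [mul_inv_cancel₀ hχ0]
          exact Complex.one_mem_slitPlane))] with p h1 h2 h3 h4
    exact ⟨h1, h2, h3, h4⟩
  obtain ⟨δ, hδ, hδr, hδU⟩ := exists_box_subset hr hev
  have hbox : box q δ ⊆ box q r := prod_mono (ball_subset_ball hδr) (ball_subset_ball hδr)
  have hκδ := hκd.mono hbox
  have hκδ' := hκd'.mono hbox
  have hχδ : ∀ y ∈ ball (star q) δ, χ y ≠ 0 ∧ χ y * (χ (star q))⁻¹ ∈ Complex.slitPlane :=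
    fun y hy => (hδU (show (q, y) ∈ box q δ from ⟨mem_ball_self hδ, hy⟩)).2.2
  have hinv : DifferentiableOn ℂ (fun p => (κ' p)⁻¹) (box q δ) :=
    hκδ'.fun_inv fun p hp => (hδU hp).1
  -- Here 1 + ι = κ/κ' with κ' the kernel of χS', so -log(1 + ι) lies in the ideal. On y = x̄ it
  -- differs from log(‖S'‖²/‖S‖²) by log|χ|².
  set ι : (Fin (n + 1) → ℂ) × (Fin (n + 1) → ℂ) → ℂ :=
    fun p => (κ' p)⁻¹ • (κ p - κ' p) with hι
  have hιd : DifferentiableOn ℂ ι (box q δ) := hinv.fun_smul (hκδ.fun_sub hκδ')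
  have hι1 : ∀ p ∈ box q δ, 1 + ι p = κ p * (κ' p)⁻¹ := fun p hp => by
    have := (hδU hp).1
    simp only [hι, smul_eq_mul]
    field_simp
    ring
  have hιJ : JetVanish k q δ ι := (h.mono hδr).smul (hκδ.fun_sub hκδ') hinv
  have hO : IsOpen {z : ℂ | 1 + z ∈ Complex.slitPlane} :=
    Complex.isOpen_slitPlane.preimage (by fun_prop)
  have hmaps : MapsTo ι (box q δ) {z : ℂ | 1 + z ∈ Complex.slitPlane} := fun p hp => by
    change 1 + ι p ∈ Complex.slitPlane
    rw [hι1 p hp]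
    exact (hδU hp).2.1
  have hlog : DifferentiableOn ℂ (fun z : ℂ => -Complex.log (1 + z))
      {z : ℂ | 1 + z ∈ Complex.slitPlane} :=
    (DifferentiableOn.clog (f := fun z => 1 + z) (by fun_prop) fun z hz => hz).fun_neg
  have hΘJ : JetVanish k q δ fun p => -Complex.log (1 + ι p) :=
    hιJ.comp hιd hO (by simp) hlog (by simp) hmaps
  have hΘd : DifferentiableOn ℂ (fun p => -Complex.log (1 + ι p)) (box q δ) :=
    hlog.comp hιd hmaps
  -- Dividing by the value at the centre keeps the argument in the slit plane. Then log|χ|² is this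
  -- logarithm plus its conjugate plus a constant, hence separated.
  have hℓd : DifferentiableOn ℂ (fun y => Complex.log (χ y * (χ (star q))⁻¹))
      (ball (star q) δ) :=
    ((hχ.mono (ball_subset_ball hδr)).mul_const _).clog fun y hy => (hχδ y hy).2
  have hAd : DifferentiableOn ℂ (fun x => -star (Complex.log (χ (star x) * (χ (star q))⁻¹)))
      (ball q δ) := by
    have := differentiableOn_conj hℓd
    rw [star_star] at this
    exact this.fun_neg
  have hBd : DifferentiableOn ℂ (fun y => -Complex.log (χ y * (χ (star q))⁻¹) -
      ((2 * Real.log ‖χ (star q)‖ : ℝ) : ℂ)) (ball (star q) δ) := hℓd.fun_neg.sub_const _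
  have hΞd : DifferentiableOn ℂ (fun p : (Fin (n + 1) → ℂ) × (Fin (n + 1) → ℂ) =>
      -Complex.log (1 + ι p) + (-star (Complex.log (χ (star p.1) * (χ (star q))⁻¹)) +
        (-Complex.log (χ p.2 * (χ (star q))⁻¹) - ((2 * Real.log ‖χ (star q)‖ : ℝ) : ℂ))))
      (box q δ) :=
    hΘd.fun_add ((hAd.comp differentiableOn_fst fun p hp => hp.1).fun_add
      (hBd.comp differentiableOn_snd fun p hp => hp.2))
  ext i j
  rw [diffArray_eq_mixedDeriv hΞd (fun x hx => ?_) (mem_ball_self hδ), Matrix.zero_apply,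
    mixedDeriv_separated hAd hBd hΘd _ _ _ _ (mk_star_mem_box (mem_ball_self hδ))]
  · exact hΘJ.mixedDeriv_opIndex_eq_zero hk hΘd i j _ (mk_star_mem_box (mem_ball_self hδ)) hq
      (by simp [hq])
  · have hxb := mk_star_mem_box hx
    have hxr := ball_subset_ball hδr hx
    have hχx := (hχδ _ hxb.2).1
    have p1 : 0 < ‖S (star x)‖ := norm_pos_iff.2 (hS0 _ (star_mem_ball_star.2 hxr))
    have p2 : 0 < ‖S' (star x)‖ := norm_pos_iff.2 (hS0' _ (star_mem_ball_star.2 hxr))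
    have p3 : 0 < ‖χ (star x)‖ := norm_pos_iff.2 hχx
    have p4 : 0 < ‖χ (star q)‖ := norm_pos_iff.2 hχ0
    have hquot : κ (x, star x) * (κ' (x, star x))⁻¹ =
        ((‖S (star x)‖ ^ 2 / (‖χ (star x)‖ * ‖S' (star x)‖) ^ 2 : ℝ) : ℂ) := by
      rw [hκ, hκ', polarKernel_antidiag, polarKernel_antidiag, norm_smul]
      push_cast
      rw [div_eq_mul_inv]
    have hℓ := log_add_star_log (χ (star x) * (χ (star q))⁻¹)
    rw [hF x hxr, hι1 _ hxb, hquot, ← Complex.ofReal_log (by positivity)]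
    simp only
    have hreal : Real.log (‖S' (star x)‖ ^ 2 / ‖S (star x)‖ ^ 2) =
        -Real.log (‖S (star x)‖ ^ 2 / (‖χ (star x)‖ * ‖S' (star x)‖) ^ 2) -
          2 * Real.log ‖χ (star x) * (χ (star q))⁻¹‖ - 2 * Real.log ‖χ (star q)‖ := by
      rw [norm_mul, norm_inv, Real.log_div (by positivity) (by positivity),
        Real.log_div (by positivity) (by positivity), Real.log_mul p3.ne' (by positivity),
        Real.log_inv, Real.log_pow, Real.log_pow, Real.log_pow,
        Real.log_mul p3.ne' p2.ne']
      push_cast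
      ring
    rw [hreal]
    push_cast at hℓ ⊢
    linear_combination hℓ

/-- If `𝒟_k` annihilates the logarithm of the quotient of the metrics on the slice, then after
shrinking the polydisc there is a holomorphic function `χ` such that the jets of `χ • S` and of
`S'` have the same Gram matrix. -/
theorem exists_jetVanish_of_diffArray_eq_zero (hr : 0 < r) (hq : q 0 = 0)
    (hS : DifferentiableOn ℂ S (ball (star q) r))
    (hS' : DifferentiableOn ℂ S' (ball (star q) r)) (hS0 : ∀ y ∈ ball (star q) r, S y ≠ 0)
    (hS0' : ∀ y ∈ ball (star q) r, S' y ≠ 0) {F : (Fin (n + 1) → ℂ) → ℂ}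
    (hF : ∀ x ∈ ball q r, F x = ((Real.log (‖S' (star x)‖ ^ 2 / ‖S (star x)‖ ^ 2) : ℝ) : ℂ))
    (hD : ∀ x ∈ ball q r, x 0 = 0 → diffArray k F x = 0) :
    ∃ δ > 0, δ ≤ r ∧ ∃ χ : (Fin (n + 1) → ℂ) → ℂ, DifferentiableOn ℂ χ (ball (star q) δ) ∧
      (∀ y ∈ ball (star q) δ, χ y ≠ 0) ∧
      JetVanish k q δ fun p => polarKernel (fun y => χ y • S y) p - polarKernel S' p := by
  have hqm : (q, star q) ∈ box q r := mk_star_mem_box (mem_ball_self hr)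
  have hκd : DifferentiableOn ℂ (polarKernel S) (box q r) := differentiableOn_polarKernel hS
  have hκd' : DifferentiableOn ℂ (polarKernel S') (box q r) := differentiableOn_polarKernel hS'
  have hdiag : ∀ x ∈ ball q r, 0 < ‖S (star x)‖ ∧ 0 < ‖S' (star x)‖ := fun x hx =>
    ⟨norm_pos_iff.2 (hS0 _ (star_mem_ball_star.2 hx)),
      norm_pos_iff.2 (hS0' _ (star_mem_ball_star.2 hx))⟩
  have hquot : ∀ x, polarKernel S' (x, star x) * (polarKernel S (x, star x))⁻¹ =
      ((‖S' (star x)‖ ^ 2 / ‖S (star x)‖ ^ 2 : ℝ) : ℂ) := fun x => by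
    rw [polarKernel_antidiag, polarKernel_antidiag]
    push_cast
    rw [div_eq_mul_inv]
  have hev : ∀ᶠ p in 𝓝 (q, star q), p ∈ {p : (Fin (n + 1) → ℂ) × (Fin (n + 1) → ℂ) |
      polarKernel S p ≠ 0 ∧ polarKernel S' p * (polarKernel S p)⁻¹ ∈ Complex.slitPlane} := by
    have c1 : ContinuousAt (polarKernel S) (q, star q) :=
      hκd.continuousOn.continuousAt (isOpen_box.mem_nhds hqm)
    have c2 : ContinuousAt (polarKernel S') (q, star q) :=
      hκd'.continuousOn.continuousAt (isOpen_box.mem_nhds hqm)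
    obtain ⟨p1, p2⟩ := hdiag q (mem_ball_self hr)
    have h0 : polarKernel S (q, star q) ≠ 0 := by
      rw [polarKernel_antidiag]
      exact_mod_cast (pow_pos p1 2).ne'
    filter_upwards [c1.eventually_ne h0, (c2.mul (c1.inv₀ h0)).eventually_mem
      (Complex.isOpen_slitPlane.mem_nhds (by
        simp only [Pi.mul_apply, Pi.inv_apply]
        rw [hquot, Complex.ofReal_mem_slitPlane]
        positivity))] with p h1 h2
    exact ⟨h1, h2⟩
  obtain ⟨δ, hδ, hδr, hδU⟩ := exists_box_subset hr hev
  have hbox : box q δ ⊆ box q r := prod_mono (ball_subset_ball hδr) (ball_subset_ball hδr)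
  have hκδ := hκd.mono hbox
  have hκδ' := hκd'.mono hbox
  set Φ : (Fin (n + 1) → ℂ) × (Fin (n + 1) → ℂ) → ℂ :=
    fun p => Complex.log (polarKernel S' p * (polarKernel S p)⁻¹) with hΦ
  have hΦd : DifferentiableOn ℂ Φ (box q δ) :=
    (hκδ'.fun_mul (hκδ.fun_inv fun p hp => (hδU hp).1)).clog fun p hp => (hδU hp).2
  have hΦF : ∀ x ∈ ball q δ, F x = Φ (x, star x) := fun x hx => by
    have hxr := ball_subset_ball hδr hx
    obtain ⟨p1, p2⟩ := hdiag x hxr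
    rw [hF x hxr, Complex.ofReal_log (by positivity), hΦ]
    simp only
    rw [hquot]
  have hexp : ∀ p ∈ box q δ, polarKernel S' p = Complex.exp (Φ p) * polarKernel S p :=
    fun p hp => by
      have h0 := (hδU hp).1
      rw [hΦ]
      simp only
      rw [Complex.exp_log (Complex.slitPlane_ne_zero (hδU hp).2)]
      field_simp
  have hΦD : ∀ i j : Fin n ⊕ Fin (k - 1), ∀ p ∈ box q δ, p.1 0 = 0 → p.2 0 = 0 →
      mixedDeriv (opIndex i).1 ((opIndex i).2 + 1) (opIndex j).1 ((opIndex j).2 + 1) Φ p = 0 := by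
    rintro i j ⟨x, y⟩ ⟨hx, hy⟩ hx0 hy0
    -- The hypothesis concerns only y = x̄ on Z; polarisation gives all x, y with x₀ = y₀ = 0.
    refine eq_zero_of_eq_zero_on_antidiagonal (differentiableOn_mixedDeriv hΦd _ _ _ _)
      (fun x hx hx0 => ?_) hx hy hx0 hy0
    rw [← diffArray_eq_mixedDeriv hΦd hΦF hx, hD x (ball_subset_ball hδr hx) hx0]
    rfl
  have hxm : ∀ x ∈ ball q δ, (x, star q) ∈ box q δ := fun x hx =>
    ⟨hx, mem_ball_self hδ⟩
  have hym : ∀ y ∈ ball (star q) δ, (q, y) ∈ box q δ := fun y hy => ⟨mem_ball_self hδ, hy⟩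
  have hAd : DifferentiableOn ℂ (fun x => -Φ (x, star q) + Φ (q, star q)) (ball q δ) := by
    have : DifferentiableOn ℂ (fun x => Φ (x, star q)) (ball q δ) :=
      hΦd.comp (f := fun x => (x, star q)) (by fun_prop) hxm
    exact this.fun_neg.add_const _
  have hyd : DifferentiableOn ℂ (fun y => Φ (q, y)) (ball (star q) δ) :=
    hΦd.comp (f := fun y => (q, y)) (by fun_prop) hym
  have hBd : DifferentiableOn ℂ (fun y => -Φ (q, y)) (ball (star q) δ) := hyd.fun_neg
  -- Ψ(x, y) = Φ(x, y) - Φ(x, q̄) - Φ(q, y) + Φ(q, q̄) vanishes when x = q or y = q̄, and the added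
  -- terms are separated.
  set Ψ : (Fin (n + 1) → ℂ) × (Fin (n + 1) → ℂ) → ℂ := fun p =>
    Φ p + ((fun x => -Φ (x, star q) + Φ (q, star q)) p.1 + (fun y => -Φ (q, y)) p.2) with hΨ
  have hΨd : DifferentiableOn ℂ Ψ (box q δ) :=
    hΦd.fun_add ((hAd.comp differentiableOn_fst fun p hp => hp.1).fun_add
      (hBd.comp differentiableOn_snd fun p hp => hp.2))
  have hΨJ : JetVanish k q δ Ψ := by
    refine jetVanish_of_mixedDeriv_opIndex_eq_zero hΨd hδ hq (fun x _ => ?_) (fun y _ => ?_)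
      fun i j p hp h1 h2 => ?_
    · simp only [hΨ]; ring
    · simp only [hΨ]; ring
    · rw [hΨ, mixedDeriv_separated hAd hBd hΦd _ _ _ _ hp]
      exact hΦD i j p hp h1 h2
  have hEJ : JetVanish k q δ fun p => 1 - Complex.exp (Ψ p) :=
    hΨJ.comp hΨd isOpen_univ (mem_univ _) (φ := fun z => 1 - Complex.exp z)
      (by fun_prop) (by simp) (mapsTo_univ _ _)
  have hEd : DifferentiableOn ℂ (fun p => 1 - Complex.exp (Ψ p)) (box q δ) :=
    hΨd.cexp.const_sub 1
  have hherm : ∀ y ∈ ball (star q) δ, star (Φ (q, y)) = Φ (star y, star q) := fun y hy => by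
    have h1 := (hδU (hym y hy)).2
    simp only [hΦ]
    rw [Complex.star_def, ← Complex.log_conj _ (Complex.mem_slitPlane_iff_arg.1 h1).1, map_mul,
      map_inv₀, ← Complex.star_def, star_polarKernel, star_polarKernel]
  -- Sharing the constant Φ(q, q̄) equally makes the conjugate of χ(x̄) times χ(y) equal to e^(Φ -
  -- Ψ), by hermitian symmetry of Φ.
  set χ : (Fin (n + 1) → ℂ) → ℂ := fun y => Complex.exp (Φ (q, y) - Φ (q, star q) / 2) with hχ
  have hχd : DifferentiableOn ℂ χ (ball (star q) δ) := (hyd.sub_const _).cexp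
  refine ⟨δ, hδ, hδr, χ, hχd, fun y _ => Complex.exp_ne_zero _, ?_⟩
  have hχS := differentiableOn_polarKernel (hχd.fun_smul (hS.mono (ball_subset_ball hδr)))
  -- The kernel of S' is e^Ψ times that of χS, so the difference is 1 - e^Ψ, which lies in the
  -- ideal, times the kernel of χS.
  refine (hEJ.smul hEd hχS).congr fun p hp => ?_
  have hp1 : star p.1 ∈ ball (star q) δ := star_mem_ball_star.2 hp.1
  have h1 : star (χ (star p.1)) = Complex.exp (Φ (p.1, star q) - Φ (q, star q) / 2) := by
    have h2 := hherm (star p.1) hp1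
    have h3 := hherm (star q) (mem_ball_self hδ)
    rw [star_star] at h2 h3
    simp only [hχ]
    rw [Complex.star_def, ← Complex.exp_conj, map_sub, map_div₀, ← Complex.star_def, h2, h3]
    simp
  simp only [smul_eq_mul, polarKernel_smul]
  rw [hexp p hp, h1, mul_sub, mul_one, sub_right_inj]
  have h4 : Complex.exp (Φ p) = Complex.exp (Φ (p.1, star q) - Φ (q, star q) / 2) * χ p.2 *
      Complex.exp (Ψ p) := by
    rw [hχ, ← Complex.exp_add, ← Complex.exp_add]
    congr 1
    simp only [hΨ]
    ring
  rw [h4]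
  ring

end Main

end JetQuotient

end

theorem theorem1 {n k : ℕ} (hk : 1 ≤ k) {Ω Z : Set (Fin (n + 1) → ℂ)}
    (hΩ_open : IsOpen Ω) (hΩ_conn : IsConnected Ω) (hΩ_bdd : Bornology.IsBounded Ω)
    (hZ : JetQuotient.IsHypersurface Ω Z) (hZ_conn : IsConnected Z)
    (charts : Set (OpenPartialHomeomorph (Fin (n + 1) → ℂ) (Fin (n + 1) → ℂ)))
    (hcharts : ∀ e ∈ charts, JetQuotient.IsAdaptedChart Ω Z e)
    (hcover : ∀ p ∈ Z, ∃ e ∈ charts, p ∈ e.source)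
    {H H' : Type*} [NormedAddCommGroup H] [InnerProductSpace ℂ H] [CompleteSpace H]
    [NormedAddCommGroup H'] [InnerProductSpace ℂ H'] [CompleteSpace H']
    (M : JetQuotient.QuasiFreeModule Ω H) (M' : JetQuotient.QuasiFreeModule Ω H')
    (s : (Fin (n + 1) → ℂ) → H) (hs : M.IsFrame s)
    (s' : (Fin (n + 1) → ℂ) → H') (hs' : M'.IsFrame s') :
    JetQuotient.QuotientsIsomorphic M M' Z k ↔
      JetQuotient.EquivalentToOrder Z charts k (JetQuotient.metric s) (JetQuotient.metric s') := by
  open JetQuotient Metric in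
  constructor
  · rintro hiso e hec z ⟨hze, hzZ⟩
    have he := hcharts e hec
    obtain ⟨r, hr, hball⟩ := Metric.isOpen_iff.1 e.open_target (e z) (e.map_source hze)
    have hS := hs.isLocalFrame hΩ_open he hball
    have hS' := hs'.isLocalFrame hΩ_open he hball
    obtain ⟨χ, hχ, hgram⟩ := exists_smul_gram_eq hiso hs hs' hΩ_open hZ.1 he hball hS hS'
    exact diffArray_log_eq_zero hk hr ((he.mem_iff z hze).1 hzZ) hS.differentiableOn
      hS'.differentiableOn hS.ne_zero hS'.ne_zero hχ
      ((jetVanish_polarKernel_sub_iff hS.differentiableOn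
        (hχ.fun_smul hS'.differentiableOn)).2 hgram)
      fun x _ => by simp only [metric, star_star]
  · intro h
    -- In this direction the condition is used in a single polydisc around one point of Z.
    obtain ⟨p, hp⟩ := hZ_conn.nonempty
    obtain ⟨e, hec, hpe⟩ := hcover p hp
    have he := hcharts e hec
    obtain ⟨r, hr, hball⟩ := Metric.isOpen_iff.1 e.open_target (e p) (e.map_source hpe)
    have hq : e p 0 = 0 := (he.mem_iff p hpe).1 hp
    have hS := hs.isLocalFrame hΩ_open he hball
    have hS' := hs'.isLocalFrame hΩ_open he hball
    obtain ⟨δ, hδ, hδr, χ, hχ, hχ0, hJ⟩ := exists_jetVanish_of_diffArray_eq_zero (k := k)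
      (F := fun x => ((Real.log (metric s' (e.symm x) / metric s (e.symm x)) : ℝ) : ℂ)) hr hq
      hS.differentiableOn hS'.differentiableOn hS.ne_zero hS'.ne_zero
      (fun x _ => by simp only [metric, star_star]) fun x hx hx0 => by
        have hxt := hball hx
        have := h e hec (e.symm x) ⟨e.map_target hxt, (he.symm_mem_iff hxt).2 hx0⟩
        rwa [e.right_inv hxt] at this
    have hsub := ball_subset_ball (x := e p) hδr
    have hχS := (hS.mono hsub).smul hχ hχ0
    have hS'δ := hS'.mono hsub
    exact quotientsIsomorphic_of_gram hs hs' hΩ_open he hcharts hcover hZ_conn.isPreconnected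
      (hsub.trans hball) hδ hq hχS hS'δ
      ((jetVanish_polarKernel_sub_iff hχS.differentiableOn hS'δ.differentiableOn).1 hJ)
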